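/- For nonnegative integers $n_1,n_2$ let $$G_{n_1,n_2}=\int_{\mathbb{R}^{n_1+n_2}} e^{-\sum_{i=1}^{n_1+n_2} q_i\lambda_i^2/2}\prod_{1\le i<j\le n_1+n_2}|\lambda_i-\lambda_j|^{q_iq_j}\,d\lambda_1\cdots d\lambda_{n_1+n_2},$$ where $q_i=1$ for $1\le i\le n_1$ and $q_i=2$ for $n_1+1\le i\le n_1+n_2$, be the generalized partition function of the two-component log-gas with $n_1$ particles of charge $1$ and $n_2$ particles of charge $2$, and let $$G_n=\int_{\mathbb{R}^n} e^{-\sum_{i=1}^n\lambda_i^2/2}\prod_{1\le i<j\le n}|\lambda_i-\lambda_j|\,d\lambda_1\cdots d\lambda_n$$ be the GOE partition function. Then for all positive integers $n,k$ with $n\ge 2k$, the integrals defining $G_n$ and $G_{n-2k,k}$ converge (are finite), and $$G_{n-2k,k}=2^{-2k}\,G_n.$$ -/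

import Mathlib

open MeasureTheory

noncomputable section

/-- Boltzmann factor of the GOE: `exp (-∑ i, (x i)^2 / 2) * ∏_{i < j} |x i - x j|`. -/
def goeWeight (n : ℕ) (x : Fin n → ℝ) : ℝ :=
  Real.exp (-∑ i, x i ^ 2 / 2) * ∏ i, ∏ j ∈ Finset.Ioi i, |x i - x j|

/-- The GOE partition function `G_n`. -/
def goePartition (n : ℕ) : ℝ :=
  ∫ x : Fin n → ℝ, goeWeight n x

/-- The charges: the first `n₁` particles have charge `1`, the last `n₂` have charge `2`. -/
def charge (n₁ n₂ : ℕ) (i : Fin (n₁ + n₂)) : ℕ :=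
  if (i : ℕ) < n₁ then 1 else 2

/-- Boltzmann factor of the two-component log-gas:
`exp (-∑ i, q i * (x i)^2 / 2) * ∏_{i < j} |x i - x j| ^ (q i * q j)`. -/
def twoComponentWeight (n₁ n₂ : ℕ) (x : Fin (n₁ + n₂) → ℝ) : ℝ :=
  Real.exp (-∑ i, (charge n₁ n₂ i : ℝ) * x i ^ 2 / 2) *
    ∏ i, ∏ j ∈ Finset.Ioi i, |x i - x j| ^ (charge n₁ n₂ i * charge n₁ n₂ j)

/-- The generalized partition function `G_{n₁,n₂}` of the two-component log-gas. -/
def twoComponentPartition (n₁ n₂ : ℕ) : ℝ :=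
  ∫ x : Fin (n₁ + n₂) → ℝ, twoComponentWeight n₁ n₂ x

end

/-!
The two-component Boltzmann factor is the absolute value of a confluent Vandermonde product: a
particle of charge `2` is two particles of charge `1` that have merged, with the difference of
their positions divided out. With `n = n₁ + 2 * n₂` and the Hermite functions `D ^ j w`,
`w = exp (-x ^ 2 / 2)`, `j < n`, in place of monomials, the Gaussian is absorbed and the product
becomes a determinant whose columns are `D ^ j w` at each particle of charge `1`, and `D ^ j w` and
`D ^ (j + 1) w` at each particle of charge `2` (`det_confluent`). Only the sign of the Vandermonde
product of the charge `1` particles is needed to remove the absolute value. Every term of the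
determinant is integrable, which gives convergence (`integrable_and_abs_partition_eq`).

The sign of a Vandermonde product of an even number of points is the Pfaffian of the signs of the
differences (`signDelta_add_two_eq_sum`). So after antisymmetrization the integral is `(n₁ - 1)‼`
times a sum of products of two skew forms (`IsPairingExpansion`): `∫∫ sgn (y - x) f x g y` for two
particles of charge `1`, and `∫ f g'` for one of charge `2`. Integrating by parts, both are given
on `D ^ i w`, `D ^ j w` by the moments `∫ w * D ^ l w`: the first with `l = i + j - 1` and a factor
`-2`, the second with `l = i + j + 1`. They pair even with odd degrees, hence the sum is a mixed
discriminant of a Hankel matrix and its shift (`sum_sign_mul_prod_pairings`). If `n₁` is odd, one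
particle of charge `1` is integrated alone and takes the degree `0`.

The moments satisfy the two-term recursion of a Gamma function, so each further shift multiplies
the mixed discriminant by an explicit factor (`hankelSum_insert`). Together with the double
factorials this gives `G_{n₁, n₂ + 1} = G_{n₁ + 2, n₂} / 4` up to sign, and the sign is settled by
positivity (`twoComponentPartition_succ`). Iteration from `n₂ = 0` is the claim.
-/

/-! ### Hermite functions and their moments -/

open Polynomial in
/-- The Hermite function `D ^ j w`, the `j`-th derivative of `w x = exp (-x ^ 2 / 2)`, written as
`(-1) ^ j` times the probabilists' Hermite polynomial times `w`. The factor `(-1) ^ j` is kept, so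
that differentiation is exactly the shift `j ↦ j + 1`. -/
noncomputable def hermiteFun (j : ℕ) (x : ℝ) : ℝ :=
  (-1) ^ j * aeval x (hermite j) * Real.exp (-(x ^ 2 / 2))

lemma hermiteFun_eq_iterate (j : ℕ) :
    hermiteFun j = deriv^[j] fun y ↦ Real.exp (-(y ^ 2 / 2)) := by
  ext x
  rw [Polynomial.deriv_gaussian_eq_hermite_mul_gaussian, hermiteFun]

lemma contDiff_hermiteFun (j : ℕ) : ContDiff ℝ ⊤ (hermiteFun j) := by
  unfold hermiteFun
  have := Polynomial.contDiff_aeval (𝕜 := ℝ) (Polynomial.hermite j) ⊤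
  fun_prop

lemma continuous_hermiteFun (j : ℕ) : Continuous (hermiteFun j) :=
  (contDiff_hermiteFun j).continuous

lemma hasDerivAt_hermiteFun (j : ℕ) (x : ℝ) :
    HasDerivAt (hermiteFun j) (hermiteFun (j + 1) x) x := by
  have h : hermiteFun (j + 1) = deriv (hermiteFun j) := by
    rw [hermiteFun_eq_iterate, hermiteFun_eq_iterate, Function.iterate_succ_apply']
  rw [h]
  exact ((contDiff_hermiteFun j).differentiable (by simp)).differentiableAt.hasDerivAt

lemma hermiteFun_zero (x : ℝ) : hermiteFun 0 x = Real.exp (-(x ^ 2 / 2)) := by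
  simp [hermiteFun]

lemma hermiteFun_one (x : ℝ) : hermiteFun 1 x = -x * hermiteFun 0 x := by
  simp [hermiteFun]

lemma hermiteFun_succ_succ (j : ℕ) (x : ℝ) :
    hermiteFun (j + 2) x = -x * hermiteFun (j + 1) x - (j + 1) * hermiteFun j x := by
  induction j generalizing x with
  | zero =>
    have h1 : HasDerivAt (fun y ↦ -y * hermiteFun 0 y)
        (-1 * hermiteFun 0 x + -x * hermiteFun 1 x) x :=
      (hasDerivAt_id x).neg.mul (hasDerivAt_hermiteFun 0 x)
    have h2 := hasDerivAt_hermiteFun 1 x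
    rw [show hermiteFun 1 = fun y ↦ -y * hermiteFun 0 y from funext hermiteFun_one] at h2
    have := h2.unique h1
    simp only [zero_add] at this ⊢
    rw [this]; push_cast; ring
  | succ j ih =>
    have h1 : HasDerivAt (fun y ↦ -y * hermiteFun (j + 1) y - (j + 1) * hermiteFun j y)
        ((-1 * hermiteFun (j + 1) x + -x * hermiteFun (j + 2) x)
          - (j + 1) * hermiteFun (j + 1) x) x :=
      ((hasDerivAt_id x).neg.mul (hasDerivAt_hermiteFun (j + 1) x)).sub
        ((hasDerivAt_hermiteFun j x).const_mul _)
    have h2 := hasDerivAt_hermiteFun (j + 2) x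
    rw [show hermiteFun (j + 2) = fun y ↦ -y * hermiteFun (j + 1) y - (j + 1) * hermiteFun j y
      from funext ih] at h2
    have := h2.unique h1
    rw [this, ih x]; push_cast; ring

lemma integrable_aeval_mul_exp (p : Polynomial ℤ) {b : ℝ} (hb : 0 < b) :
    Integrable fun x : ℝ ↦ Polynomial.aeval x p * Real.exp (-b * x ^ 2) := by
  induction p using Polynomial.induction_on' with
  | add p q hp hq =>
    refine (hp.add hq).congr (.of_forall fun x ↦ ?_)
    simp [add_mul]
  | monomial n a =>
    have := (integrable_rpow_mul_exp_neg_mul_sq hb (s := n)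
      (by linarith [n.cast_nonneg (α := ℝ)])).const_mul (a : ℝ)
    simpa [Real.rpow_natCast, mul_assoc, Polynomial.aeval_monomial] using this

lemma integrable_hermiteFun (j : ℕ) : Integrable (hermiteFun j) := by
  have := (integrable_aeval_mul_exp (Polynomial.hermite j) (b := 1 / 2) (by norm_num)).const_mul
    ((-1) ^ j)
  refine this.congr (.of_forall fun x ↦ ?_)
  simp only [hermiteFun]
  rw [mul_assoc]; congr 3; ring

lemma integrable_hermiteFun_mul (i j : ℕ) :
    Integrable fun x ↦ hermiteFun i x * hermiteFun j x := by
  have := (integrable_aeval_mul_exp (Polynomial.hermite i * Polynomial.hermite j) (b := 1)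
    (by norm_num)).const_mul ((-1) ^ i * (-1) ^ j)
  refine this.congr (.of_forall fun x ↦ ?_)
  have : Real.exp (-1 * x ^ 2) = Real.exp (-(x ^ 2 / 2)) * Real.exp (-(x ^ 2 / 2)) := by
    rw [← Real.exp_add]; congr 1; ring
  simp only [hermiteFun, map_mul, this]
  ring

lemma tendsto_hermiteFun_atTop (j : ℕ) :
    Filter.Tendsto (hermiteFun j) Filter.atTop (nhds 0) :=
  tendsto_zero_of_hasDerivAt_of_integrableOn_Ioi (a := 0)
    (fun x _ ↦ hasDerivAt_hermiteFun j x) (integrable_hermiteFun (j + 1)).integrableOn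
    (integrable_hermiteFun j).integrableOn

lemma tendsto_hermiteFun_atBot (j : ℕ) :
    Filter.Tendsto (hermiteFun j) Filter.atBot (nhds 0) :=
  tendsto_zero_of_hasDerivAt_of_integrableOn_Iic (a := 0)
    (fun x _ ↦ hasDerivAt_hermiteFun j x) (integrable_hermiteFun (j + 1)).integrableOn
    (integrable_hermiteFun j).integrableOn

lemma integral_hermiteFun_succ (j : ℕ) : ∫ x, hermiteFun (j + 1) x = 0 := by
  simpa using integral_of_hasDerivAt_of_tendsto (hasDerivAt_hermiteFun j)
    (integrable_hermiteFun (j + 1)) (tendsto_hermiteFun_atBot j) (tendsto_hermiteFun_atTop j)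

/-- The number `∫ w * D ^ l w`. By integration by parts it determines all `∫ D ^ i w * D ^ j w`. -/
noncomputable def hermiteMoment (l : ℕ) : ℝ := ∫ x, hermiteFun 0 x * hermiteFun l x

lemma integral_hermiteFun_succ_mul (i j : ℕ) :
    ∫ x, hermiteFun (i + 1) x * hermiteFun j x = -∫ x, hermiteFun i x * hermiteFun (j + 1) x := by
  have := integral_mul_deriv_eq_deriv_mul_of_integrable
    (u := hermiteFun i) (v := hermiteFun j) (u' := hermiteFun (i + 1)) (v' := hermiteFun (j + 1))
    (fun x _ ↦ hasDerivAt_hermiteFun i x) (fun x _ ↦ hasDerivAt_hermiteFun j x)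
    (integrable_hermiteFun_mul _ _) (integrable_hermiteFun_mul _ _) (integrable_hermiteFun_mul _ _)
  rw [this, neg_neg]

lemma integral_hermiteFun_mul (i j : ℕ) :
    ∫ x, hermiteFun i x * hermiteFun j x = (-1) ^ i * hermiteMoment (i + j) := by
  induction i generalizing j with
  | zero => simp [hermiteMoment]
  | succ i ih =>
    rw [integral_hermiteFun_succ_mul, ih, pow_succ]
    rw [show i + (j + 1) = i + 1 + j by ring]; ring

lemma hermiteMoment_one : hermiteMoment 1 = 0 := by
  have := integral_hermiteFun_succ_mul 0 0
  rw [show ∫ x, hermiteFun (0 + 1) x * hermiteFun 0 x = ∫ x, hermiteFun 0 x * hermiteFun (0 + 1) x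
    from integral_congr_ae (.of_forall fun x ↦ mul_comm _ _)] at this
  simp only [zero_add] at this
  unfold hermiteMoment
  linarith

lemma hermiteMoment_succ_succ (l : ℕ) :
    hermiteMoment (l + 2) = -((l + 1) / 2) * hermiteMoment l := by
  have h : hermiteMoment (l + 2) = ∫ x, (hermiteFun 1 x * hermiteFun (l + 1) x
      - (l + 1) * (hermiteFun 0 x * hermiteFun l x)) :=
    integral_congr_ae (.of_forall fun x ↦ by
      simp only [hermiteFun_succ_succ, hermiteFun_one]; ring)
  rw [integral_sub (integrable_hermiteFun_mul _ _) ((integrable_hermiteFun_mul _ _).const_mul _),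
    integral_const_mul, integral_hermiteFun_mul, integral_hermiteFun_mul] at h
  rw [show 1 + (l + 1) = l + 2 by ring, zero_add] at h
  simp only [pow_zero, pow_one] at h
  linarith

lemma hermiteMoment_of_odd {l : ℕ} (hl : Odd l) : hermiteMoment l = 0 := by
  obtain ⟨m, rfl⟩ := hl
  induction m with
  | zero => exact hermiteMoment_one
  | succ m ih =>
    rw [show 2 * (m + 1) + 1 = 2 * m + 1 + 2 by ring, hermiteMoment_succ_succ, ih, mul_zero]

/-! ### The two skew forms on Hermite functions -/

/-- The sign of `t`, with the value `1` at `t = 0`. It is only applied to differences `x j - x i`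
with `i < j`; ties are then broken by the index, so that the sign identities below hold for every
`x`, not just for almost every `x`. -/
noncomputable def stepSign (t : ℝ) : ℝ := if 0 ≤ t then 1 else -1

lemma abs_eq_stepSign_mul (t : ℝ) : |t| = stepSign t * t := by
  unfold stepSign
  split_ifs with h
  · rw [abs_of_nonneg h, one_mul]
  · rw [abs_of_neg (not_le.1 h)]; ring

lemma abs_stepSign (t : ℝ) : |stepSign t| = 1 := by
  unfold stepSign
  split_ifs <;> simp

lemma measurable_stepSign : Measurable stepSign :=
  Measurable.ite measurableSet_Ici measurable_const measurable_const

/-- The skew form `∫∫ sgn (y - x) D ^ i w (x) D ^ j w (y)` that comes from a pair of particles of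
charge `1`. -/
noncomputable def signPairing (i j : ℕ) : ℝ :=
  ∫ x, hermiteFun i x * ∫ y, stepSign (y - x) * hermiteFun j y

lemma integral_stepSign_mul (f : ℝ → ℝ) (hf : Integrable f) (x : ℝ) :
    ∫ y, stepSign (y - x) * f y = (∫ y in Set.Ioi x, f y) - ∫ y in Set.Iic x, f y := by
  have h1 : Integrable fun y ↦ stepSign (y - x) * f y := by
    refine hf.bdd_mul (c := 1) (measurable_stepSign.comp (by fun_prop)).aestronglyMeasurable
      (.of_forall fun y ↦ (abs_stepSign _).le)
  rw [← integral_add_compl measurableSet_Ioi h1, Set.compl_Ioi, sub_eq_add_neg,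
    ← integral_neg]
  congr 1
  · refine setIntegral_congr_fun measurableSet_Ioi fun y hy ↦ ?_
    have : 0 ≤ y - x := sub_nonneg.2 (Set.mem_Ioi.1 hy).le
    simp [stepSign, this]
  · rw [setIntegral_congr_set Iio_ae_eq_Iic.symm, setIntegral_congr_set Iio_ae_eq_Iic.symm]
    refine setIntegral_congr_fun measurableSet_Iio fun y hy ↦ ?_
    have : ¬ 0 ≤ y - x := not_le.2 (sub_neg.2 hy)
    simp only [stepSign, this, if_false]
    ring

lemma integral_stepSign_mul_hermiteFun_succ (j : ℕ) (x : ℝ) :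
    ∫ y, stepSign (y - x) * hermiteFun (j + 1) y = -2 * hermiteFun j x := by
  rw [integral_stepSign_mul _ (integrable_hermiteFun _),
    integral_Ioi_of_hasDerivAt_of_tendsto' (fun y _ ↦ hasDerivAt_hermiteFun j y)
      (integrable_hermiteFun _).integrableOn (tendsto_hermiteFun_atTop j),
    integral_Iic_of_hasDerivAt_of_tendsto' (fun y _ ↦ hasDerivAt_hermiteFun j y)
      (integrable_hermiteFun _).integrableOn (tendsto_hermiteFun_atBot j)]
  ring

lemma signPairing_succ_right (i j : ℕ) :
    signPairing i (j + 1) = -2 * (-1) ^ i * hermiteMoment (i + j) := by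
  simp only [signPairing, integral_stepSign_mul_hermiteFun_succ]
  rw [mul_assoc, ← integral_hermiteFun_mul, ← integral_const_mul]
  exact integral_congr_ae (.of_forall fun x ↦ by ring)

lemma integrable_stepSign_mul_mul {f g : ℝ → ℝ} (hf : Integrable f) (hg : Integrable g) :
    Integrable (fun p : ℝ × ℝ ↦ stepSign (p.2 - p.1) * (f p.1 * g p.2)) :=
  (hf.mul_prod hg).bdd_mul (c := 1)
    (measurable_stepSign.comp (by fun_prop)).aestronglyMeasurable
    (.of_forall fun y ↦ (abs_stepSign _).le)

lemma signPairing_eq_integral_prod (i j : ℕ) :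
    signPairing i j =
      ∫ p : ℝ × ℝ, stepSign (p.2 - p.1) * (hermiteFun i p.1 * hermiteFun j p.2) := by
  rw [Measure.volume_eq_prod, MeasureTheory.integral_prod _
    (integrable_stepSign_mul_mul (integrable_hermiteFun i) (integrable_hermiteFun j)), signPairing]
  refine integral_congr_ae (.of_forall fun x ↦ ?_)
  simp only
  rw [← integral_const_mul]
  exact integral_congr_ae (.of_forall fun y ↦ by ring)

lemma signPairing_swap (i j : ℕ) : signPairing j i = -signPairing i j := by
  have hI := integrable_stepSign_mul_mul (integrable_hermiteFun i) (integrable_hermiteFun j)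
  have hI' := integrable_stepSign_mul_mul (integrable_hermiteFun j) (integrable_hermiteFun i)
  rw [signPairing_eq_integral_prod i j, signPairing_eq_integral_prod j i,
    Measure.volume_eq_prod, MeasureTheory.integral_prod _ hI', MeasureTheory.integral_prod_symm _ hI,
    ← integral_neg]
  refine integral_congr_ae (.of_forall fun x ↦ ?_)
  simp only
  rw [← integral_neg]
  refine integral_congr_ae ?_
  -- the two kernels differ only on the diagonal
  filter_upwards [compl_mem_ae_iff.2 (measure_singleton x)] with y hy
  have hy : y ≠ x := hy
  unfold stepSign
  rcases lt_or_gt_of_ne hy with h | h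
  · rw [if_neg (by linarith), if_pos (by linarith)]; ring
  · rw [if_pos (by linarith), if_neg (by linarith)]; ring

lemma signPairing_of_even {i j : ℕ} (h : Even (i + j)) : signPairing i j = 0 := by
  rcases j with _ | j
  · rcases i with _ | i
    · linarith [signPairing_swap 0 0]
    · rw [signPairing_swap, signPairing_succ_right, hermiteMoment_of_odd, mul_zero, neg_zero]
      grind
  · rw [signPairing_succ_right, hermiteMoment_of_odd, mul_zero]
    grind

/-- The skew form `∫ f g'` on the Hermite functions, which comes from a particle of charge `2`. -/
noncomputable def derivPairing (i j : ℕ) : ℝ := ∫ x, hermiteFun i x * hermiteFun (j + 1) x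

lemma derivPairing_eq (i j : ℕ) : derivPairing i j = (-1) ^ i * hermiteMoment (i + j + 1) :=
  integral_hermiteFun_mul _ _

lemma derivPairing_of_even {i j : ℕ} (h : Even (i + j)) : derivPairing i j = 0 := by
  rw [derivPairing_eq, hermiteMoment_of_odd h.add_one, mul_zero]

lemma derivPairing_swap (i j : ℕ) : derivPairing j i = -derivPairing i j := by
  rw [derivPairing, ← neg_neg (∫ x, _), ← integral_hermiteFun_succ_mul, derivPairing]
  congr 1
  exact integral_congr_ae (.of_forall fun x ↦ by ring)

/-! ### The sign of the Vandermonde product -/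

/-- The alternating sum over the ranks of the elements of a finite set telescopes. -/
lemma sum_neg_one_pow_card_lt {ι α : Type*} [DecidableEq ι] [LinearOrder α] (s : Finset ι)
    (y : ι → α) (hy : Function.Injective y) :
    ∑ a ∈ s, (-1 : ℝ) ^ (s.filter fun b ↦ y b < y a).card = if Even s.card then 0 else 1 := by
  induction s using Finset.induction_on_max_value y with
  | empty => simp
  | insert a s ha hmax ih =>
    have hlt : ∀ b ∈ s, y b < y a := fun b hb ↦
      (hmax b hb).lt_of_ne fun h ↦ ha (hy h ▸ hb)
    rw [Finset.sum_insert ha, Finset.filter_insert, if_neg (lt_irrefl _),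
      Finset.filter_true_of_mem hlt, Finset.card_insert_of_notMem ha]
    rw [Finset.sum_congr rfl (g := fun b ↦ (-1 : ℝ) ^ (s.filter fun c ↦ y c < y b).card), ih]
    · rcases Nat.even_or_odd s.card with h | h
      · simp [h, Nat.even_add_one]
      · simp [h.neg_one_pow, Nat.not_even_iff_odd.2 h, h.add_one]
    · intro b hb
      rw [Finset.filter_insert, if_neg (hlt b hb).not_gt]

/-- The sign of the Vandermonde product `∏_{i < j} (x j - x i)`. -/
noncomputable def signDelta (m : ℕ) (x : Fin m → ℝ) : ℝ :=
  ∏ i, ∏ j ∈ Finset.Ioi i, stepSign (x j - x i)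

/-- The number of points of `x` below `x j`, where ties are broken by the index. -/
noncomputable def numBelow {m : ℕ} (x : Fin m → ℝ) (j : Fin m) : ℕ :=
  (Finset.univ.filter fun i ↦ toLex (x i, i) < toLex (x j, j)).card

lemma toLex_lt_iff {m : ℕ} (x : Fin m → ℝ) (i j : Fin m) :
    toLex (x i, i) < toLex (x j, j) ↔ x i < x j ∨ x i = x j ∧ i < j := by
  simp [Prod.Lex.toLex_lt_toLex]

lemma sum_neg_one_pow_numBelow {m : ℕ} (x : Fin m → ℝ) :
    ∑ j, (-1 : ℝ) ^ numBelow x j = if Even m then 0 else 1 := by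
  have := sum_neg_one_pow_card_lt Finset.univ (fun i ↦ toLex (x i, i))
    (fun i j h ↦ congrArg Prod.snd (toLex.injective h))
  rw [Finset.card_univ, Fintype.card_fin] at this
  exact this

lemma prod_Ioi_eq_prod_ite {m : ℕ} (g : Fin m → Fin m → ℝ) :
    ∏ i, ∏ j ∈ Finset.Ioi i, g i j = ∏ i, ∏ j, if i < j then g i j else 1 := by
  refine Finset.prod_congr rfl fun i _ ↦ ?_
  rw [← Finset.prod_filter]
  congr 1
  ext j
  simp

/-- A product over pairs is split into the pairs containing `j` and the rest. -/
lemma prod_Ioi_succAbove {m : ℕ} (g : Fin (m + 1) → Fin (m + 1) → ℝ) (j : Fin (m + 1)) :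
    ∏ i, ∏ l ∈ Finset.Ioi i, g i l =
      (∏ i, if j.succAbove i < j then g (j.succAbove i) j else g j (j.succAbove i)) *
      ∏ i, ∏ l ∈ Finset.Ioi i, g (j.succAbove i) (j.succAbove l) := by
  rw [prod_Ioi_eq_prod_ite, prod_Ioi_eq_prod_ite, Fin.prod_univ_succAbove _ j,
    Fin.prod_univ_succAbove _ j]
  simp only [Fin.prod_univ_succAbove _ j, lt_irrefl, if_false, one_mul,
    Fin.succAbove_lt_succAbove_iff, Finset.prod_mul_distrib]
  rw [← mul_assoc, ← Finset.prod_mul_distrib]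
  congr 1
  refine Finset.prod_congr rfl fun i _ ↦ ?_
  rcases lt_or_gt_of_ne (Fin.succAbove_ne j i) with h | h
  · simp [h, h.not_gt]
  · simp [h, h.not_gt]

lemma prod_ite_neg_one {ι : Type*} (s : Finset ι) (p : ι → Prop) [DecidablePred p] :
    ∏ i ∈ s, (if p i then (-1 : ℝ) else 1) = (-1) ^ (s.filter p).card := by
  rw [← Finset.prod_filter, Finset.prod_const]

lemma card_filter_succAbove {m : ℕ} (j : Fin (m + 1)) (p : Fin (m + 1) → Prop) [DecidablePred p]
    (hj : ¬ p j) : (Finset.univ.filter fun i ↦ p (j.succAbove i)).card =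
      (Finset.univ.filter p).card := by
  simp only [Finset.card_filter, Fin.sum_univ_succAbove _ j, hj, if_false, zero_add]

lemma stepSign_sub_of_lt {m : ℕ} (x : Fin m → ℝ) {i j : Fin m} (h : i < j) :
    stepSign (x j - x i) = if toLex (x j, j) < toLex (x i, i) then -1 else 1 := by
  unfold stepSign
  simp only [toLex_lt_iff]
  rcases lt_or_ge (x j) (x i) with h' | h'
  · rw [if_neg (by linarith), if_pos (Or.inl h')]
  · rw [if_pos (by linarith), if_neg]
    rintro (h1 | ⟨_, h2⟩)
    · exact h1.not_ge h'
    · exact h.not_gt h2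

lemma stepSign_sub_of_lt' {m : ℕ} (x : Fin m → ℝ) {i j : Fin m} (h : i < j) :
    stepSign (x j - x i) = -(if toLex (x i, i) < toLex (x j, j) then -1 else 1) := by
  rw [stepSign_sub_of_lt x h]
  have hne : toLex (x i, i) ≠ toLex (x j, j) := fun e ↦
    h.ne (congrArg Prod.snd (toLex.injective e))
  rcases lt_or_gt_of_ne hne with h' | h'
  · rw [if_neg h'.not_gt, if_pos h', neg_neg]
  · rw [if_pos h', if_neg h'.not_gt]

lemma signDelta_succ {m : ℕ} (x : Fin (m + 1) → ℝ) (j : Fin (m + 1)) :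
    signDelta (m + 1) x =
      (-1) ^ (j : ℕ) * (-1) ^ numBelow x j * signDelta m (x ∘ j.succAbove) := by
  unfold signDelta
  rw [prod_Ioi_succAbove (fun i l ↦ stepSign (x l - x i)) j]
  simp only [Function.comp]
  congr 1
  have hj : ((Finset.univ.filter fun i : Fin m ↦ j.succAbove i < j).card) = (j : ℕ) := by
    rw [card_filter_succAbove j (fun i ↦ i < j) (lt_irrefl _), ← Fin.card_Iio]
    congr 1; ext; simp
  have hb : ((Finset.univ.filter fun i : Fin m ↦
      toLex (x (j.succAbove i), j.succAbove i) < toLex (x j, j)).card) = numBelow x j :=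
    card_filter_succAbove j (fun i ↦ toLex (x i, i) < toLex (x j, j)) (lt_irrefl _)
  rw [← hj, ← hb, ← prod_ite_neg_one, ← prod_ite_neg_one, ← Finset.prod_mul_distrib]
  refine Finset.prod_congr rfl fun i _ ↦ ?_
  split_ifs with h1 h2 h2
  · rw [stepSign_sub_of_lt' x h1, if_pos h2]; ring
  · rw [stepSign_sub_of_lt' x h1, if_neg h2]; ring
  · have h1 := lt_of_le_of_ne (not_lt.1 h1) (Fin.succAbove_ne j i).symm
    rw [stepSign_sub_of_lt x h1, if_pos h2]; ring
  · have h1 := lt_of_le_of_ne (not_lt.1 h1) (Fin.succAbove_ne j i).symm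
    rw [stepSign_sub_of_lt x h1, if_neg h2]; ring

lemma neg_one_pow_mul_self (n : ℕ) : (-1 : ℝ) ^ n * (-1) ^ n = 1 := by
  rw [← mul_pow]; simp

lemma neg_one_pow_mul_signDelta_succAbove {m : ℕ} (x : Fin (m + 1) → ℝ) (j : Fin (m + 1)) :
    (-1) ^ (j : ℕ) * signDelta m (x ∘ j.succAbove) =
      (-1) ^ numBelow x j * signDelta (m + 1) x := by
  rw [signDelta_succ x j]
  linear_combination (-(-1) ^ (j : ℕ) * signDelta m (x ∘ j.succAbove)) *
    neg_one_pow_mul_self (numBelow x j)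

/-- Expansion of the sign of the Vandermonde product of an odd number of points, along the point
left out. It is the bordered variant of `signDelta_add_two_eq_sum`. -/
lemma signDelta_succ_eq_sum {m : ℕ} (hm : Even m) (x : Fin (m + 1) → ℝ) :
    signDelta (m + 1) x = ∑ j : Fin (m + 1), (-1) ^ (j : ℕ) * signDelta m (x ∘ j.succAbove) := by
  simp_rw [neg_one_pow_mul_signDelta_succAbove, ← Finset.sum_mul, sum_neg_one_pow_numBelow]
  simp [Nat.even_add_one, hm]

lemma neg_one_pow_numBelow_succ {m : ℕ} (x : Fin (m + 1) → ℝ) (j : Fin m) :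
    (-1 : ℝ) ^ numBelow x j.succ =
      -stepSign (x j.succ - x 0) * (-1) ^ numBelow (x ∘ Fin.succ) j := by
  unfold numBelow
  rw [← prod_ite_neg_one, ← prod_ite_neg_one, Fin.prod_univ_succ,
    stepSign_sub_of_lt' x (Fin.succ_pos j), neg_neg]
  simp [Prod.Lex.toLex_lt_toLex]

/-- For an even number of points the sign of the Vandermonde product is the Pfaffian of the signs
of the differences; this is its expansion along the first row. -/
lemma signDelta_add_two_eq_sum {m : ℕ} (hm : Even m) (x : Fin (m + 2) → ℝ) :
    signDelta (m + 2) x = ∑ j : Fin (m + 1), (-1) ^ (j : ℕ) *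
      (stepSign (x j.succ - x 0) * signDelta m (x ∘ Fin.succ ∘ j.succAbove)) := by
  have h1 : ∀ j : Fin (m + 1), (-1) ^ (j : ℕ) *
      (stepSign (x j.succ - x 0) * signDelta m (x ∘ Fin.succ ∘ j.succAbove)) =
      -(-1) ^ numBelow x j.succ * signDelta (m + 1) (x ∘ Fin.succ) := fun j ↦ by
    have := neg_one_pow_mul_signDelta_succAbove (x ∘ Fin.succ) j
    rw [neg_one_pow_numBelow_succ]
    rw [Function.comp_assoc] at this
    linear_combination stepSign (x j.succ - x 0) * this
  have h2 := sum_neg_one_pow_numBelow x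
  rw [Fin.sum_univ_succ, if_pos (by grind)] at h2
  rw [Finset.sum_congr rfl fun j _ ↦ h1 j, ← Finset.sum_mul, Finset.sum_neg_distrib,
    signDelta_succ x 0]
  have h3 : (x ∘ Fin.succAbove 0) = x ∘ Fin.succ := by simp [Fin.succAbove_zero]
  rw [h3]
  simp only [Fin.val_zero, pow_zero, one_mul]
  linear_combination signDelta (m + 1) (x ∘ Fin.succ) * h2

lemma abs_signDelta (m : ℕ) (x : Fin m → ℝ) : |signDelta m x| = 1 := by
  simp [signDelta, Finset.abs_prod, abs_stepSign]

lemma measurable_signDelta (m : ℕ) : Measurable (signDelta m) := by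
  unfold signDelta
  refine Finset.measurable_prod _ fun i _ ↦ Finset.measurable_prod _ fun j _ ↦ ?_
  exact measurable_stepSign.comp (by fun_prop)

/-- The Hermite function integral against the sign of the Vandermonde product. -/
noncomputable def signIntegral (m : ℕ) (f : Fin m → ℕ) : ℝ :=
  ∫ x : Fin m → ℝ, signDelta m x * ∏ i, hermiteFun (f i) (x i)

lemma integrable_prod_hermiteFun {ι : Type*} [Fintype ι] (f : ι → ℕ) :
    Integrable fun x : ι → ℝ ↦ ∏ i, hermiteFun (f i) (x i) :=
  Integrable.fintype_prod (f := fun i ↦ hermiteFun (f i)) fun i ↦ integrable_hermiteFun (f i)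

lemma signIntegral_zero (f : Fin 0 → ℕ) : signIntegral 0 f = 1 := by
  simp [signIntegral, signDelta, measureReal_def, volume_pi]

lemma integral_piFinSuccAbove {m : ℕ} (F : (Fin (m + 1) → ℝ) → ℝ) (j : Fin (m + 1)) :
    ∫ x, F x = ∫ p : ℝ × (Fin m → ℝ), F (j.insertNth p.1 p.2) :=
  ((volume_preserving_piFinSuccAbove (fun _ : Fin (m + 1) ↦ ℝ) j).symm).integral_comp
    (MeasurableEquiv.measurableEmbedding _) F |>.symm

lemma integrable_piFinSuccAbove {m : ℕ} {F : (Fin (m + 1) → ℝ) → ℝ} (hF : Integrable F)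
    (j : Fin (m + 1)) :
    Integrable fun p : ℝ × (Fin m → ℝ) ↦ F (j.insertNth p.1 p.2) :=
  ((volume_preserving_piFinSuccAbove (fun _ : Fin (m + 1) ↦ ℝ) j).symm)
    |>.integrable_comp_of_integrable hF

lemma signIntegral_succ {m : ℕ} (hm : Even m) (f : Fin (m + 1) → ℕ) :
    signIntegral (m + 1) f = ∑ j : Fin (m + 1),
      (-1) ^ (j : ℕ) * ((∫ t, hermiteFun (f j) t) * signIntegral m (f ∘ j.succAbove)) := by
  have hI : ∀ j : Fin (m + 1), Integrable fun x : Fin (m + 1) → ℝ ↦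
      signDelta m (x ∘ j.succAbove) * ∏ i, hermiteFun (f i) (x i) := fun j ↦ by
    refine (integrable_prod_hermiteFun f).bdd_mul (c := 1) ?_
      (.of_forall fun y ↦ (abs_signDelta _ _).le)
    exact ((measurable_signDelta m).comp (by fun_prop)).aestronglyMeasurable
  rw [signIntegral]
  simp_rw [signDelta_succ_eq_sum hm, Finset.sum_mul, mul_assoc]
  rw [integral_finsetSum _ fun j _ ↦ (hI j).const_mul _]
  refine Finset.sum_congr rfl fun j _ ↦ ?_
  rw [integral_const_mul, integral_piFinSuccAbove _ j, signIntegral, ← integral_prod_mul,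
    Measure.volume_eq_prod]
  congr 1
  refine integral_congr_ae (.of_forall fun p ↦ ?_)
  simp only [Fin.prod_univ_succAbove _ j, Fin.insertNth_apply_same, Fin.insertNth_apply_succAbove]
  have : (j.insertNth p.1 p.2 : Fin (m + 1) → ℝ) ∘ j.succAbove = p.2 := by ext i; simp
  rw [this]
  simp only [Function.comp]; ring

lemma signIntegral_add_two {m : ℕ} (hm : Even m) (f : Fin (m + 2) → ℕ) :
    signIntegral (m + 2) f = ∑ j : Fin (m + 1), (-1) ^ (j : ℕ) *
      (signPairing (f 0) (f j.succ) * signIntegral m (f ∘ Fin.succ ∘ j.succAbove)) := by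
  have hI : ∀ j : Fin (m + 1), Integrable fun x : Fin (m + 2) → ℝ ↦
      stepSign (x j.succ - x 0) * signDelta m (x ∘ Fin.succ ∘ j.succAbove) *
        ∏ i, hermiteFun (f i) (x i) := fun j ↦ by
    refine (integrable_prod_hermiteFun f).bdd_mul (c := 1) ?_
      (.of_forall fun y ↦ ?_)
    · exact ((measurable_stepSign.comp (by fun_prop)).mul
        ((measurable_signDelta m).comp (by fun_prop))).aestronglyMeasurable
    · rw [norm_mul, Real.norm_eq_abs, Real.norm_eq_abs, abs_stepSign, abs_signDelta, one_mul]
  rw [signIntegral]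
  simp_rw [signDelta_add_two_eq_sum hm, Finset.sum_mul, mul_assoc]
  simp_rw [← mul_assoc (stepSign _)]
  rw [integral_finsetSum _ fun j _ ↦ (hI j).const_mul _]
  refine Finset.sum_congr rfl fun j _ ↦ ?_
  rw [integral_const_mul]
  congr 1
  have h0 := integrable_piFinSuccAbove (hI j) 0
  rw [integral_piFinSuccAbove _ 0, Measure.volume_eq_prod, integral_prod _ h0, signPairing,
    ← integral_mul_const]
  refine integral_congr_ae (.of_forall fun t ↦ ?_)
  simp only
  rw [integral_piFinSuccAbove _ j, mul_assoc, signIntegral, ← integral_prod_mul,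
    ← integral_const_mul, Measure.volume_eq_prod]
  refine integral_congr_ae (.of_forall fun p ↦ ?_)
  have h1 : (Fin.insertNth 0 t (j.insertNth p.1 p.2 : Fin (m + 1) → ℝ) : Fin (m + 2) → ℝ) ∘
      Fin.succ ∘ j.succAbove = p.2 := by ext i; simp
  simp only [h1, Fin.prod_univ_succ, Fin.prod_univ_succAbove _ j]
  simp only [Fin.insertNth_zero', Fin.cons_succ, Fin.insertNth_apply_same,
    Fin.insertNth_apply_succAbove, Function.comp]
  ring

/-! ### Antisymmetrization over the slots -/

section Antisymmetrization
open Equiv Finset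

/-- The permutation of `ι` that acts as `τ` on the part `α` of `α ⊕ κ ≃ ι` and fixes the rest. -/
def slotPerm {α ι κ : Type*} (e : α ⊕ κ ≃ ι) (τ : Perm α) : Perm ι :=
  e.permCongr (Equiv.sumCongr τ (Equiv.refl κ))

lemma slotPerm_inl {α ι κ : Type*} (e : α ⊕ κ ≃ ι) (τ : Perm α) (a : α) :
    slotPerm e τ (e (Sum.inl a)) = e (Sum.inl (τ a)) := by
  simp [slotPerm, Equiv.permCongr_apply]

lemma slotPerm_inr {α ι κ : Type*} (e : α ⊕ κ ≃ ι) (τ : Perm α) (b : κ) :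
    slotPerm e τ (e (Sum.inr b)) = e (Sum.inr b) := by
  simp [slotPerm, Equiv.permCongr_apply]

variable {ι κ : Type*} [Fintype ι] [DecidableEq ι] [Fintype κ] [DecidableEq κ]

lemma sign_mul_sign_self {α : Type*} [Fintype α] [DecidableEq α] (τ : Perm α) :
    ((Perm.sign τ : ℤ) : ℝ) * ((Perm.sign τ : ℤ) : ℝ) = 1 := by
  rcases Int.units_eq_one_or (Perm.sign τ) with h | h <;> simp [h]

lemma sum_sign_mul_perm (F : Perm ι → ℝ) (T : Perm ι) :
    ∑ σ : Perm ι, ((Perm.sign σ : ℤ) : ℝ) * F (σ * T) =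
      ((Perm.sign T : ℤ) : ℝ) * ∑ σ : Perm ι, ((Perm.sign σ : ℤ) : ℝ) * F σ := by
  rw [mul_sum]
  refine Fintype.sum_equiv (Equiv.mulRight T) _ _ fun σ ↦ ?_
  have hs := sign_mul_sign_self T
  rw [Equiv.coe_mulRight, Perm.sign_mul]
  push_cast
  linear_combination (-((Perm.sign σ : ℤ) : ℝ) * F (σ * T)) * hs

lemma sign_slotPerm {α : Type*} [Fintype α] [DecidableEq α] (e : α ⊕ κ ≃ ι) (τ : Perm α) :
    Perm.sign (slotPerm e τ) = Perm.sign τ := by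
  rw [slotPerm, Perm.sign_permCongr, Perm.sign_sumCongr, Perm.sign_refl, mul_one]

/-- Under antisymmetrization over all slots, the terms of an expansion that differ by permutations
of the slots, weighted by their signs, all contribute the same. -/
lemma sum_sign_mul_eq_of_expansion {α : Type*} [Fintype α] [DecidableEq α] {n : ℕ}
    (e : α ⊕ κ ≃ ι) (g : ι → ℕ) (R : (κ → ℕ) → ℝ) (F G : (α → ℕ) → ℝ) (τ : Fin n → Perm α)
    (hF : ∀ f, F f = ∑ j, ((Perm.sign (τ j) : ℤ) : ℝ) * G (f ∘ τ j)) :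
    ∑ σ : Perm ι, ((Perm.sign σ : ℤ) : ℝ) *
      (F (fun i ↦ g (σ (e (Sum.inl i)))) * R fun i ↦ g (σ (e (Sum.inr i)))) =
    n * ∑ σ : Perm ι, ((Perm.sign σ : ℤ) : ℝ) *
      (G (fun i ↦ g (σ (e (Sum.inl i)))) * R fun i ↦ g (σ (e (Sum.inr i)))) := by
  have h1 : ∀ j, ((Perm.sign (τ j) : ℤ) : ℝ) * ∑ σ : Perm ι, ((Perm.sign σ : ℤ) : ℝ) *
      (G ((fun i ↦ g (σ (e (Sum.inl i)))) ∘ τ j) * R fun i ↦ g (σ (e (Sum.inr i)))) =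
      ∑ σ : Perm ι, ((Perm.sign σ : ℤ) : ℝ) *
      (G (fun i ↦ g (σ (e (Sum.inl i)))) * R fun i ↦ g (σ (e (Sum.inr i)))) := fun j ↦ by
    have := sum_sign_mul_perm (fun σ : Perm ι ↦ G (fun i ↦ g (σ (e (Sum.inl i)))) *
      R fun i ↦ g (σ (e (Sum.inr i)))) (slotPerm e (τ j))
    simp only [Perm.mul_apply, slotPerm_inl, slotPerm_inr, sign_slotPerm] at this
    have hs := sign_mul_sign_self (τ j)
    simp only [Function.comp_def]
    rw [this, ← mul_assoc, hs, one_mul]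
  calc _ = ∑ j, ((Perm.sign (τ j) : ℤ) : ℝ) * ∑ σ : Perm ι, ((Perm.sign σ : ℤ) : ℝ) *
      (G ((fun i ↦ g (σ (e (Sum.inl i)))) ∘ τ j) * R fun i ↦ g (σ (e (Sum.inr i)))) := by
        simp_rw [mul_sum]
        rw [sum_comm]
        refine sum_congr rfl fun σ _ ↦ ?_
        rw [hF, sum_mul, mul_sum]
        exact sum_congr rfl fun j _ ↦ by ring
    _ = _ := by
        rw [sum_congr rfl fun j _ ↦ h1 j, sum_const, card_univ, Fintype.card_fin, nsmul_eq_mul]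

lemma sum_sign_mul_signIntegral_succ {m : ℕ} (hm : Even m) (e : Fin (m + 1) ⊕ κ ≃ ι) (g : ι → ℕ)
    (R : (κ → ℕ) → ℝ) :
    ∑ σ : Perm ι, ((Perm.sign σ : ℤ) : ℝ) *
      (signIntegral (m + 1) (fun i ↦ g (σ (e (Sum.inl i)))) *
        R fun i ↦ g (σ (e (Sum.inr i)))) =
    (m + 1) * ∑ σ : Perm ι, ((Perm.sign σ : ℤ) : ℝ) *
      ((∫ t, hermiteFun (g (σ (e (Sum.inl 0)))) t) *
        signIntegral m (fun i ↦ g (σ (e (Sum.inl i.succ)))) *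
        R fun i ↦ g (σ (e (Sum.inr i)))) := by
  rw [sum_sign_mul_eq_of_expansion (n := m + 1) e g R _
    (fun f ↦ (∫ t, hermiteFun (f 0) t) * signIntegral m (f ∘ Fin.succ))
    (fun j ↦ j.cycleRange.symm)]
  · push_cast; rfl
  · intro f
    rw [signIntegral_succ hm]
    refine sum_congr rfl fun j _ ↦ ?_
    have : (f ∘ j.cycleRange.symm) ∘ Fin.succ = f ∘ j.succAbove := by ext i; simp
    rw [this]
    simp [Perm.sign_symm, Fin.sign_cycleRange]

lemma sum_sign_mul_signIntegral_add_two {m : ℕ} (hm : Even m) (e : Fin (m + 2) ⊕ κ ≃ ι)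
    (g : ι → ℕ) (R : (κ → ℕ) → ℝ) :
    ∑ σ : Perm ι, ((Perm.sign σ : ℤ) : ℝ) *
      (signIntegral (m + 2) (fun i ↦ g (σ (e (Sum.inl i)))) *
        R fun i ↦ g (σ (e (Sum.inr i)))) =
    (m + 1) * ∑ σ : Perm ι, ((Perm.sign σ : ℤ) : ℝ) *
      (signPairing (g (σ (e (Sum.inl 0)))) (g (σ (e (Sum.inl 1)))) *
        signIntegral m (fun i ↦ g (σ (e (Sum.inl i.succ.succ)))) *
        R fun i ↦ g (σ (e (Sum.inr i)))) := by
  rw [sum_sign_mul_eq_of_expansion (n := m + 1) e g R _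
    (fun f ↦ signPairing (f 0) (f 1) * signIntegral m (f ∘ Fin.succ ∘ Fin.succ))
    (fun j ↦ Perm.decomposeFin.symm (0, j.cycleRange.symm))]
  · push_cast; rfl
  · intro f
    rw [signIntegral_add_two hm]
    refine sum_congr rfl fun j _ ↦ ?_
    have : (f ∘ (Perm.decomposeFin.symm (0, j.cycleRange.symm))) ∘ Fin.succ ∘ Fin.succ =
        f ∘ Fin.succ ∘ j.succAbove := by
      ext i
      simp
    rw [this]
    simp [Perm.sign_symm, Fin.sign_cycleRange]

lemma doubleFactorial_two_mul_succ_sub_one (m : ℕ) :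
    (Nat.doubleFactorial (2 * (m + 1) - 1) : ℝ) =
      (2 * m + 1) * Nat.doubleFactorial (2 * m - 1) := by
  rcases m with _ | m
  · simp
  · rw [show 2 * (m + 1 + 1) - 1 = (2 * m + 1) + 2 by omega, Nat.doubleFactorial_add_two]
    push_cast
    rw [show 2 * (m + 1) - 1 = 2 * m + 1 by omega]
    ring

/-- The antisymmetrization of `signIntegral (2 * m)`, possibly together with further slots indexed
by `κ`, is `(2 * m - 1)‼` times that of the product of the `signPairing`s over the pairs
`(e₂ (inl p), e₂ (inr p))`. -/
def IsPairingExpansion {m : ℕ} (e₂ : Fin m ⊕ Fin m ≃ Fin (2 * m)) : Prop :=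
  ∀ (ι κ : Type) [Fintype ι] [DecidableEq ι] [Fintype κ] [DecidableEq κ]
    (e : Fin (2 * m) ⊕ κ ≃ ι) (g : ι → ℕ) (R : (κ → ℕ) → ℝ),
    ∑ σ : Perm ι, ((Perm.sign σ : ℤ) : ℝ) *
      (signIntegral (2 * m) (fun i ↦ g (σ (e (Sum.inl i)))) *
        R fun i ↦ g (σ (e (Sum.inr i)))) =
    (Nat.doubleFactorial (2 * m - 1)) * ∑ σ : Perm ι, ((Perm.sign σ : ℤ) : ℝ) *
      ((∏ p, signPairing (g (σ (e (Sum.inl (e₂ (Sum.inl p))))))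
        (g (σ (e (Sum.inl (e₂ (Sum.inr p))))))) *
        R fun i ↦ g (σ (e (Sum.inr i))))

/-- Iterating `sum_sign_mul_signIntegral_add_two` splits the particles of charge `1` into pairs. -/
lemma exists_isPairingExpansion (m : ℕ) :
    ∃ e₂ : Fin m ⊕ Fin m ≃ Fin (2 * m), IsPairingExpansion e₂ := by
  induction m with
  | zero =>
    have : IsEmpty (Fin (2 * 0)) := Fin.isEmpty
    refine ⟨Equiv.equivOfIsEmpty _ _, fun ι κ _ _ _ _ e g R ↦ ?_⟩
    have h : ∀ f : Fin (2 * 0) → ℕ, signIntegral (2 * 0) f = 1 := signIntegral_zero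
    simp [h]
  | succ m ih =>
    obtain ⟨e₂, he₂⟩ := ih
    -- the new pair occupies the slots `0` and `1`
    let s₁ : Fin (m + 1) → Fin (2 * m + 2) := Fin.cons 0 fun p ↦ (e₂ (Sum.inl p)).succ.succ
    let s₂ : Fin (m + 1) → Fin (2 * m + 2) := Fin.cons 1 fun p ↦ (e₂ (Sum.inr p)).succ.succ
    have hbij : Function.Bijective (Sum.elim s₁ s₂) := by
      rw [Fintype.bijective_iff_injective_and_card]
      refine ⟨?_, by simp; ring⟩
      rintro (p | p) (q | q) h <;> induction p using Fin.cases <;> induction q using Fin.cases <;>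
        simp [s₁, s₂, Fin.ext_iff] at h ⊢
      all_goals simpa [Fin.ext_iff] using e₂.injective (Fin.ext h)
    refine ⟨Equiv.ofBijective _ hbij, fun ι κ _ _ _ _ e g R ↦ ?_⟩
    have h1 := sum_sign_mul_signIntegral_add_two (even_two_mul m) e g R
    let c : Fin (2 * m) ⊕ (Fin 2 ⊕ κ) ≃ Fin (2 * m + 2) ⊕ κ :=
      (Equiv.sumAssoc _ _ _).symm.trans (Equiv.sumCongr
        ((Equiv.sumComm _ _).trans (finSumFinEquiv.trans (finCongr (add_comm _ _)))) (Equiv.refl κ))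
    have c1 : ∀ i, c (Sum.inl i) = Sum.inl i.succ.succ := fun i ↦ by
      simp [c, Fin.ext_iff]
    have c2 : c (Sum.inr (Sum.inl 0)) = Sum.inl 0 := by
      simp [c, Fin.ext_iff]
    have c3 : c (Sum.inr (Sum.inl 1)) = Sum.inl 1 := by
      simp [c, Fin.ext_iff]
    have c4 : ∀ b, c (Sum.inr (Sum.inr b)) = Sum.inr b := fun i ↦ by
      simp [c]
    have h2 := he₂ ι (Fin 2 ⊕ κ) (c.trans e) g
      (fun f ↦ signPairing (f (Sum.inl 0)) (f (Sum.inl 1)) * R fun b ↦ f (Sum.inr b))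
    simp only [Equiv.trans_apply, c1, c2, c3, c4] at h2
    rw [doubleFactorial_two_mul_succ_sub_one, mul_assoc]
    push_cast at h1
    refine h1.trans ?_
    congr 1
    calc _ = _ := sum_congr rfl fun σ _ ↦ by ring
      _ = _ := h2
      _ = _ := by
        congr 1
        refine sum_congr rfl fun σ _ ↦ ?_
        rw [Fin.prod_univ_succ]
        simp only [Equiv.ofBijective_apply, Sum.elim_inl, Sum.elim_inr, s₁, s₂, Fin.cons_zero,
          Fin.cons_succ]
        ring
end Antisymmetrization

/-! ### Hankel sums -/

open Equiv Finset in
/-- The mixed discriminant of `r` Hankel matrices, up to a factor: the pair `p` uses the Hankel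
matrix of `η` shifted by one if `p ∈ B` and unshifted otherwise. For the moments of a weight `v` it
is the integral of `∏_{p ∈ B} t p * ∏_{p < q} (t p - t q) ^ 2 * ∏ v (t p)`. -/
noncomputable def hankelSum (r : ℕ) (η : ℕ → ℝ) (B : Finset (Fin r)) : ℝ :=
  ∑ α : Perm (Fin r), ∑ β : Perm (Fin r), ((Perm.sign α : ℤ) : ℝ) * ((Perm.sign β : ℤ) : ℝ) *
    ∏ p, η (α p + β p + if p ∈ B then 1 else 0)

section Hankel
open Equiv Finset

variable {r : ℕ}

/-- If shifting the values of `α` on `B` by one produces no coincidence, then `α` maps `B` to an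
upper set. -/
lemma mem_of_le_of_injective {B : Finset (Fin r)} {α : Perm (Fin r)}
    (h : Function.Injective fun p ↦ (α p : ℕ) + if p ∈ B then 1 else 0) (d : ℕ) :
    ∀ p q, q ∈ B → (α p : ℕ) = α q + d → p ∈ B := by
  induction d with
  | zero =>
    intro p q hq hpq
    rwa [α.injective (Fin.ext hpq)]
  | succ d ih =>
    intro p q hq hpq
    have hlt : (α q : ℕ) + 1 < r := by have := (α p).isLt; omega
    refine ih p (α.symm ⟨α q + 1, hlt⟩) ?_ (by simp; omega)
    by_contra hB
    have := @h q (α.symm ⟨α q + 1, hlt⟩) (by simp [hq, hB])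
    rw [← this] at hB
    exact hB hq

/-- If shifting the values of `α` on `B` by one produces no coincidence, then `α` maps the
complement of `B` onto an initial segment, so the sum of its values there is a triangular number.
-/
lemma sum_compl_of_injective {B : Finset (Fin r)} {α : Perm (Fin r)}
    (h : Function.Injective fun p ↦ (α p : ℕ) + if p ∈ B then 1 else 0) :
    ∑ p ∈ Bᶜ, ((α p : ℕ) : ℝ) = (#Bᶜ * (#Bᶜ - 1) : ℝ) / 2 := by
  have hinj : Function.Injective fun p ↦ (α p : ℕ) := Fin.val_injective.comp α.injective
  have himg : Bᶜ.image (fun p ↦ (α p : ℕ)) = range #Bᶜ := by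
    refine eq_of_subset_of_card_le (fun i hi ↦ ?_) ?_
    · obtain ⟨p, hp, rfl⟩ := mem_image.1 hi
      -- everything below `α p` comes from the complement of `B`
      have hsub : range (α p + 1) ⊆ Bᶜ.image fun p ↦ (α p : ℕ) := fun j hj ↦ by
        have hj : j ≤ α p := by simpa [Nat.lt_succ_iff] using hj
        have hjr : j < r := hj.trans_lt (α p).isLt
        refine mem_image.2 ⟨α.symm ⟨j, hjr⟩, ?_, by simp⟩
        rw [mem_compl] at hp ⊢
        exact fun hq ↦ hp (mem_of_le_of_injective h (α p - j) p _ hq (by simp; omega))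
      have := card_le_card hsub
      rw [card_image_of_injective _ hinj, card_range] at this
      exact mem_range.2 this
    · rw [card_image_of_injective _ hinj, card_range]
  have h2 : ∑ p ∈ Bᶜ, (α p : ℕ) = ∑ i ∈ range #Bᶜ, i := by
    rw [← himg, sum_image hinj.injOn]
  rw [← Nat.cast_sum, h2, eq_div_iff two_ne_zero]
  have h3 := sum_range_id_mul_two #Bᶜ
  rcases Nat.eq_zero_or_pos #Bᶜ with h0 | h0
  · simp [h0]
  · have h4 := congrArg (Nat.cast : ℕ → ℝ) h3
    rw [Nat.cast_mul, Nat.cast_mul, Nat.cast_sub h0] at h4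
    simpa using h4

lemma sum_sign_mul_prod_eq_zero (η : ℕ → ℝ) (f : Fin r → ℕ) (hf : ¬ Function.Injective f) :
    ∑ β : Perm (Fin r), ((Perm.sign β : ℤ) : ℝ) * ∏ p, η (f p + β p) = 0 := by
  obtain ⟨p, q, hpq, hne⟩ := Function.not_injective_iff.1 hf
  have := Matrix.det_zero_of_column_eq (M := Matrix.of fun j i : Fin r ↦ η (f i + j)) hne
    (fun j ↦ by simp [hpq])
  rw [Matrix.det_apply'] at this
  simpa using this

/-- Inserting the value `α p₀` at an unshifted position `p₀` multiplies the sum by the mean of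
`0, …, #Bᶜ - 1`. All unshifted positions contribute the same, and the permutations `α` for which
their values are not exactly `0, …, #Bᶜ - 1` yield a determinant with two equal columns. -/
lemma sum_val_mul_hankel (η : ℕ → ℝ) (B : Finset (Fin r)) {p₀ : Fin r} (hp₀ : p₀ ∉ B) :
    ∑ α : Perm (Fin r), ∑ β : Perm (Fin r), ((Perm.sign α : ℤ) : ℝ) * ((Perm.sign β : ℤ) : ℝ) *
      (((α p₀ : ℕ) : ℝ) * ∏ p, η (α p + β p + if p ∈ B then 1 else 0)) =
    ((#Bᶜ : ℝ) - 1) / 2 * hankelSum r η B := by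
  set Y : Fin r → ℝ := fun q ↦
    ∑ α : Perm (Fin r), ∑ β : Perm (Fin r), ((Perm.sign α : ℤ) : ℝ) * ((Perm.sign β : ℤ) : ℝ) *
      (((α q : ℕ) : ℝ) * ∏ p, η (α p + β p + if p ∈ B then 1 else 0)) with hY
  have hsymm : ∀ q ∈ Bᶜ, Y q = Y p₀ := fun q hq ↦ by
    rw [mem_compl] at hq
    simp only [hY]
    refine Fintype.sum_equiv (Equiv.mulRight (swap q p₀)) _ _ fun α ↦
      Fintype.sum_equiv (Equiv.mulRight (swap q p₀)) _ _ fun β ↦ ?_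
    have hprod : ∏ p, η (α p + β p + if p ∈ B then 1 else 0) =
        ∏ p, η ((α * swap q p₀) p + (β * swap q p₀) p + if p ∈ B then 1 else 0) := by
      refine Fintype.prod_equiv (swap q p₀) _ _ fun p ↦ ?_
      have : swap q p₀ p ∈ B ↔ p ∈ B := by
        by_cases h1 : p = q
        · simp [h1, hq, hp₀]
        · by_cases h2 : p = p₀
          · simp [h2, hq, hp₀]
          · rw [swap_apply_of_ne_of_ne h1 h2]
      simp [this]
    simp only [Equiv.coe_mulRight]
    rw [← hprod, Perm.sign_mul, Perm.sign_mul]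
    have hs := sign_mul_sign_self (swap q p₀)
    push_cast
    simp only [Function.comp_apply, swap_apply_right]
    linear_combination (-((Perm.sign α : ℤ) : ℝ) * ((Perm.sign β : ℤ) : ℝ) *
      (((α q : ℕ) : ℝ) * ∏ p, η (α p + β p + if p ∈ B then 1 else 0))) * hs
  have hsum : ∑ q ∈ Bᶜ, Y q = (#Bᶜ * (#Bᶜ - 1) : ℝ) / 2 * hankelSum r η B := by
    simp only [hY]
    rw [sum_comm, hankelSum, mul_sum]
    refine sum_congr rfl fun α _ ↦ ?_
    have e1 : ∀ c : ℝ, ∑ β : Perm (Fin r), ((Perm.sign α : ℤ) : ℝ) * ((Perm.sign β : ℤ) : ℝ) *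
        (c * ∏ p, η (α p + β p + if p ∈ B then 1 else 0)) = ((Perm.sign α : ℤ) : ℝ) * c *
        ∑ β : Perm (Fin r), ((Perm.sign β : ℤ) : ℝ) *
          ∏ p, η ((α p + if p ∈ B then 1 else 0) + β p) := fun c ↦ by
      rw [mul_sum]
      refine sum_congr rfl fun β _ ↦ ?_
      simp_rw [add_right_comm _ (β _ : ℕ)]
      ring
    rw [sum_congr rfl fun q _ ↦ e1 _, ← sum_mul, ← mul_sum]
    have e2 := e1 1
    simp only [one_mul, mul_one] at e2
    rw [e2]
    by_cases h : Function.Injective fun p ↦ (α p : ℕ) + if p ∈ B then 1 else 0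
    · rw [sum_compl_of_injective h]; ring
    · rw [sum_sign_mul_prod_eq_zero η _ h]; simp
  rw [sum_congr rfl hsymm, sum_const, nsmul_eq_mul] at hsum
  have hpos : (#Bᶜ : ℝ) ≠ 0 := by
    have : p₀ ∈ Bᶜ := mem_compl.2 hp₀
    exact_mod_cast (card_pos.2 ⟨p₀, this⟩).ne'
  have : (#Bᶜ : ℝ) * Y p₀ = #Bᶜ * (((#Bᶜ : ℝ) - 1) / 2 * hankelSum r η B) := by
    rw [hsum]; ring
  exact mul_left_cancel₀ hpos this

/-- Shifting one more position multiplies the sum by an explicit factor when `η` satisfies the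
recursion of the moments of a Laguerre weight. This is the algebraic form of Aomoto's recursion for
the Selberg integral with exponent `2`. -/
lemma hankelSum_insert {η : ℕ → ℝ} {s : ℝ} (hη : ∀ l, η (l + 1) = -(l + s) * η l)
    (B : Finset (Fin r)) {p₀ : Fin r} (hp₀ : p₀ ∉ B) :
    hankelSum r η (insert p₀ B) = -(((#Bᶜ : ℝ) - 1) + s) * hankelSum r η B := by
  have h1 := sum_val_mul_hankel η B hp₀
  have h2 : ∑ α : Perm (Fin r), ∑ β : Perm (Fin r),
      ((Perm.sign α : ℤ) : ℝ) * ((Perm.sign β : ℤ) : ℝ) *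
      (((β p₀ : ℕ) : ℝ) * ∏ p, η (α p + β p + if p ∈ B then 1 else 0)) =
      ((#Bᶜ : ℝ) - 1) / 2 * hankelSum r η B := by
    rw [← h1, sum_comm]
    refine sum_congr rfl fun α _ ↦ sum_congr rfl fun β _ ↦ ?_
    simp_rw [add_comm (α _ : ℕ)]
    ring
  have h3 : hankelSum r η (insert p₀ B) = -(∑ α : Perm (Fin r), ∑ β : Perm (Fin r),
      ((Perm.sign α : ℤ) : ℝ) * ((Perm.sign β : ℤ) : ℝ) *
      (((α p₀ : ℕ) : ℝ) * ∏ p, η (α p + β p + if p ∈ B then 1 else 0))) -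
      (∑ α : Perm (Fin r), ∑ β : Perm (Fin r),
      ((Perm.sign α : ℤ) : ℝ) * ((Perm.sign β : ℤ) : ℝ) *
      (((β p₀ : ℕ) : ℝ) * ∏ p, η (α p + β p + if p ∈ B then 1 else 0))) -
      s * hankelSum r η B := by
    simp only [hankelSum, mul_sum, ← sum_neg_distrib, ← sum_sub_distrib]
    refine sum_congr rfl fun α _ ↦ sum_congr rfl fun β _ ↦ ?_
    rw [← mul_prod_erase univ _ (mem_univ p₀), ← mul_prod_erase univ
      (fun p ↦ η (α p + β p + if p ∈ B then 1 else 0)) (mem_univ p₀)]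
    have : ∏ p ∈ univ.erase p₀, η (α p + β p + if p ∈ insert p₀ B then 1 else 0) =
        ∏ p ∈ univ.erase p₀, η (α p + β p + if p ∈ B then 1 else 0) := by
      refine prod_congr rfl fun p hp ↦ ?_
      simp [(mem_erase.1 hp).1]
    rw [this]
    simp only [mem_insert_self, if_true, hp₀, if_false, add_zero]
    rw [hη]
    push_cast
    ring
  rw [h3, h1, h2]; ring
end Hankel

/-! ### Reduction of the antisymmetrized pairings to Hankel sums -/

section PairSum
open Equiv Finset

variable {ρ : Type*} [Fintype ρ] [DecidableEq ρ]

/-- The part of a form on `ρ ⊕ ρ` that takes its first argument from the left half and its second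
from the right half. A skew form vanishing on both halves is its half form minus the swapped one.
-/
def halfForm (C : ρ ⊕ ρ → ρ ⊕ ρ → ℝ) : ρ ⊕ ρ → ρ ⊕ ρ → ℝ
  | Sum.inl i, Sum.inr j => C (Sum.inl i) (Sum.inr j)
  | _, _ => 0

lemma sum_sign_mul_prod_sumCongr (H : ρ → ρ ⊕ ρ → ρ ⊕ ρ → ℝ) :
    ∑ σ : Perm (ρ ⊕ ρ), ((Perm.sign σ : ℤ) : ℝ) *
      ∏ p, halfForm (H p) (σ (Sum.inl p)) (σ (Sum.inr p)) =
    ∑ α : Perm ρ, ∑ β : Perm ρ, ((Perm.sign α : ℤ) : ℝ) * ((Perm.sign β : ℤ) : ℝ) *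
      ∏ p, H p (Sum.inl (α p)) (Sum.inr (β p)) := by
  rw [← Fintype.sum_prod_type' (f := fun α β : Perm ρ ↦
    ((Perm.sign α : ℤ) : ℝ) * ((Perm.sign β : ℤ) : ℝ) *
      ∏ p, H p (Sum.inl (α p)) (Sum.inr (β p)))]
  symm
  refine sum_of_injOn (fun q : Perm ρ × Perm ρ ↦ Equiv.sumCongr q.1 q.2) ?_ ?_ ?_ ?_
  · intro q _ q' _ h
    have h2 : ∀ x, Equiv.sumCongr q.1 q.2 x = Equiv.sumCongr q'.1 q'.2 x := DFunLike.congr_fun h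
    ext x
    · simpa using h2 (Sum.inl x)
    · simpa using h2 (Sum.inr x)
  · simp
  · -- a permutation that does not preserve the two halves contributes nothing
    intro σ _ hσ
    have h1 : ¬ ∀ x, ∃ y, Sum.inl y = σ (Sum.inl x) := fun h ↦ hσ <| by
      obtain ⟨q, hq⟩ := Perm.mem_sumCongrHom_range_of_perm_mapsTo_inl (σ := σ) (by
        rintro _ ⟨x, rfl⟩
        exact h x)
      exact ⟨q, by simp, hq⟩
    obtain ⟨a, ha⟩ := not_forall.mp h1
    rcases hx : σ (Sum.inl a) with b | b
    · exact absurd ⟨b, hx.symm⟩ ha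
    · rw [prod_eq_zero (mem_univ a), mul_zero]
      rw [hx]
      rfl
  · intro q _
    simp [halfForm, Perm.sign_sumCongr]

/-- The antisymmetrized product of skew forms, one for each pair of slots, that pair the two halves
of `ρ ⊕ ρ` with each other is, up to the factor `2` for each pair, a sum over permutations of the
two halves separately. -/
lemma sum_sign_mul_prod_pairs (C : ρ → ρ ⊕ ρ → ρ ⊕ ρ → ℝ) (hC : ∀ p u v, C p v u = -C p u v)
    (hl : ∀ p i j, C p (Sum.inl i) (Sum.inl j) = 0)
    (hr : ∀ p i j, C p (Sum.inr i) (Sum.inr j) = 0) :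
    ∑ σ : Perm (ρ ⊕ ρ), ((Perm.sign σ : ℤ) : ℝ) * ∏ p, C p (σ (Sum.inl p)) (σ (Sum.inr p)) =
    2 ^ Fintype.card ρ * ∑ α : Perm ρ, ∑ β : Perm ρ,
      ((Perm.sign α : ℤ) : ℝ) * ((Perm.sign β : ℤ) : ℝ) *
      ∏ p, C p (Sum.inl (α p)) (Sum.inr (β p)) := by
  have hhalf : ∀ p u v, C p u v = halfForm (C p) u v - halfForm (C p) v u := by
    rintro p (i | i) (j | j)
    · simp [halfForm, hl]
    · simp [halfForm]
    · simp [halfForm, hC p (Sum.inl j)]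
    · simp [halfForm, hr]
  -- replace the forms by their halves, one pair at a time
  have key : ∀ T : Finset ρ,
      ∑ σ : Perm (ρ ⊕ ρ), ((Perm.sign σ : ℤ) : ℝ) * ∏ p, C p (σ (Sum.inl p)) (σ (Sum.inr p)) =
      2 ^ #T * ∑ σ : Perm (ρ ⊕ ρ), ((Perm.sign σ : ℤ) : ℝ) *
        ∏ p, (if p ∈ T then halfForm (C p) else C p) (σ (Sum.inl p)) (σ (Sum.inr p)) := by
    intro T
    induction T using Finset.induction_on with
    | empty => simp
    | insert a T ha ih =>
      rw [ih, card_insert_of_notMem ha, pow_succ, mul_assoc]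
      congr 1
      have hrest : ∀ σ : Perm (ρ ⊕ ρ), ∏ p ∈ univ.erase a,
          (if p ∈ insert a T then halfForm (C p) else C p) (σ (Sum.inl p)) (σ (Sum.inr p)) =
          ∏ p ∈ univ.erase a,
          (if p ∈ T then halfForm (C p) else C p) (σ (Sum.inl p)) (σ (Sum.inr p)) := fun σ ↦ by
        refine prod_congr rfl fun p hp ↦ ?_
        simp [(mem_erase.1 hp).1]
      simp_rw [← mul_prod_erase univ _ (mem_univ a), hrest]
      simp only [ha, if_false, mem_insert_self, if_true]
      have hswap := sum_sign_mul_perm (fun σ : Perm (ρ ⊕ ρ) ↦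
        halfForm (C a) (σ (Sum.inl a)) (σ (Sum.inr a)) * ∏ p ∈ univ.erase a,
          (if p ∈ T then halfForm (C p) else C p) (σ (Sum.inl p)) (σ (Sum.inr p)))
        (swap (Sum.inl a) (Sum.inr a))
      rw [Perm.sign_swap Sum.inl_ne_inr] at hswap
      have hrest' : ∀ σ : Perm (ρ ⊕ ρ), ∏ p ∈ univ.erase a,
          (if p ∈ T then halfForm (C p) else C p)
            ((σ * swap (Sum.inl a) (Sum.inr a)) (Sum.inl p))
            ((σ * swap (Sum.inl a) (Sum.inr a)) (Sum.inr p)) =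
          ∏ p ∈ univ.erase a,
          (if p ∈ T then halfForm (C p) else C p) (σ (Sum.inl p)) (σ (Sum.inr p)) := fun σ ↦ by
        refine prod_congr rfl fun p hp ↦ ?_
        have hpa : p ≠ a := (mem_erase.1 hp).1
        rw [Perm.mul_apply, Perm.mul_apply, swap_apply_of_ne_of_ne (by simpa using hpa) (by simp),
          swap_apply_of_ne_of_ne (by simp) (by simpa using hpa)]
      simp only [hrest'] at hswap
      simp only [Perm.mul_apply, swap_apply_left, swap_apply_right] at hswap
      simp_rw [hhalf a, sub_mul, mul_sub, sum_sub_distrib]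
      rw [hswap]
      push_cast
      ring
  rw [key univ, card_univ]
  simp only [mem_univ, if_true]
  rw [sum_sign_mul_prod_sumCongr]

/-- The enumeration of the degrees `δ, …, δ + 2 * r - 1`, those of the parity of `δ` on the left and
the others on the right. -/
def hermiteDegree (δ r : ℕ) : Fin r ⊕ Fin r → ℕ
  | Sum.inl i => 2 * i + δ
  | Sum.inr j => 2 * j + 1 + δ

/-- The moments `(-1) ^ δ * ∫ w * D ^ (2 * l + 2 * δ) w`. Up to sign they are Gamma values: the
moments of the Laguerre weight `t ^ (δ - 1 / 2) * exp (-t)` on the half line. -/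
noncomputable def shiftedMoment (δ l : ℕ) : ℝ := (-1) ^ δ * hermiteMoment (2 * l + 2 * δ)

lemma shiftedMoment_succ (δ l : ℕ) :
    shiftedMoment δ (l + 1) = -(l + (δ + 1 / 2)) * shiftedMoment δ l := by
  unfold shiftedMoment
  rw [show 2 * (l + 1) + 2 * δ = 2 * l + 2 * δ + 2 by ring, hermiteMoment_succ_succ]
  push_cast; ring

lemma neg_one_pow_two_mul_add (i δ : ℕ) : (-1 : ℝ) ^ (2 * i + δ) = (-1) ^ δ := by
  rw [pow_add, pow_mul]; simp

/-- Both skew forms pair the left degree `2 * i + δ` with the right degree `2 * j + 1 + δ` through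
the Hankel matrix of `shiftedMoment δ`; the charge `2` form shifts the index of the moment by one,
the charge `1` form carries the factor `-2`. -/
lemma sum_sign_mul_prod_pairings (δ r : ℕ) (B : Finset (Fin r)) :
    ∑ σ : Perm (Fin r ⊕ Fin r), ((Perm.sign σ : ℤ) : ℝ) *
      ∏ p, (if p ∈ B then derivPairing else signPairing)
        (hermiteDegree δ r (σ (Sum.inl p))) (hermiteDegree δ r (σ (Sum.inr p))) =
    2 ^ r * (-2) ^ #Bᶜ * hankelSum r (shiftedMoment δ) B := by
  have := sum_sign_mul_prod_pairs (fun (p : Fin r) u v ↦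
    (if p ∈ B then derivPairing else signPairing) (hermiteDegree δ r u) (hermiteDegree δ r v))
    (fun p u v ↦ by split_ifs; exacts [derivPairing_swap _ _, signPairing_swap _ _])
    (fun p i j ↦ by
      have : Even (2 * (i : ℕ) + δ + (2 * j + δ)) := ⟨i + j + δ, by ring⟩
      split_ifs; exacts [derivPairing_of_even this, signPairing_of_even this])
    (fun p i j ↦ by
      have : Even (2 * (i : ℕ) + 1 + δ + (2 * j + 1 + δ)) := ⟨i + j + δ + 1, by ring⟩
      split_ifs; exacts [derivPairing_of_even this, signPairing_of_even this])
  rw [this, Fintype.card_fin, mul_assoc]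
  congr 1
  simp only [hankelSum, mul_sum]
  refine sum_congr rfl fun α _ ↦ sum_congr rfl fun β _ ↦ ?_
  rw [mul_left_comm]
  congr 1
  have h2 : (-2 : ℝ) ^ #Bᶜ = ∏ p, if p ∈ B then 1 else (-2 : ℝ) := by
    rw [← prod_const, ← prod_subset (subset_univ Bᶜ) (fun p _ hp ↦ by simp_all)]
    exact prod_congr rfl fun p hp ↦ by simp [mem_compl.1 hp]
  rw [h2, ← prod_mul_distrib]
  refine prod_congr rfl fun p _ ↦ ?_
  simp only [hermiteDegree, shiftedMoment]
  split_ifs with hp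
  · rw [derivPairing_eq, neg_one_pow_two_mul_add, one_mul]
    congr 2; ring
  · rw [show 2 * (β p : ℕ) + 1 + δ = 2 * β p + δ + 1 by ring, signPairing_succ_right,
      neg_one_pow_two_mul_add, mul_assoc]
    congr 3; ring
end PairSum

/-! ### The confluent Vandermonde determinant -/

section Confluent
open Finset

/-- The Hermite functions are monic polynomials times the Gaussian up to sign, so their determinant
is a Vandermonde product. -/
lemma det_hermiteFun {n : ℕ} (y : Fin n → ℝ) :
    (Matrix.of fun j i : Fin n ↦ hermiteFun j (y i)).det =
      (∏ j : Fin n, (-1 : ℝ) ^ (j : ℕ)) *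
        ((∏ i, hermiteFun 0 (y i)) * ∏ i, ∏ j ∈ Ioi i, (y j - y i)) := by
  rw [← Matrix.det_vandermonde, Matrix.det_eval_matrixOfPolynomials_eq_det_vandermonde y
    (fun j ↦ (Polynomial.hermite j).map (Int.castRingHom ℝ))
    (fun j ↦ by rw [(Polynomial.hermite_monic j).natDegree_map, Polynomial.natDegree_hermite])
    (fun j ↦ (Polynomial.hermite_monic j).map _), ← Matrix.det_mul_column, ← Matrix.det_mul_row,
    ← Matrix.det_transpose]
  congr 1
  ext i j
  simp [hermiteFun, Polynomial.eval_map, Polynomial.aeval_def]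
  ring

lemma prod_Ioi_add {a b : ℕ} (g : Fin (a + b) → Fin (a + b) → ℝ) :
    ∏ i, ∏ j ∈ Ioi i, g i j =
      (∏ i, ∏ j ∈ Ioi i, g (Fin.castAdd b i) (Fin.castAdd b j)) *
      (∏ i, ∏ j, g (Fin.castAdd b i) (Fin.natAdd a j)) *
      ∏ i, ∏ j ∈ Ioi i, g (Fin.natAdd a i) (Fin.natAdd a j) := by
  simp only [prod_Ioi_eq_prod_ite, Fin.prod_univ_add, prod_mul_distrib]
  have h1 : ∀ (i : Fin a) (j : Fin b), Fin.castAdd b i < Fin.natAdd a j := fun i j ↦ by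
    simp only [Fin.lt_def, Fin.val_castAdd, Fin.val_natAdd]; omega
  have h2 : ∀ i j : Fin a, Fin.castAdd b i < Fin.castAdd b j ↔ i < j := fun i j ↦ Iff.rfl
  simp [h1, h2, (h1 _ _).not_gt, mul_assoc]

lemma prod_prod_ne {k : ℕ} (g : Fin k → Fin k → ℝ) :
    ∏ p, ∏ q ∈ univ.erase p, g p q = ∏ p, ∏ q ∈ Ioi p, g p q * g q p := by
  have h1 : ∏ p, ∏ q ∈ univ.erase p, g p q =
      ∏ p, ∏ q, (if p < q then g p q else 1) * (if q < p then g p q else 1) := by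
    refine prod_congr rfl fun p _ ↦ ?_
    rw [← mul_prod_erase univ _ (mem_univ p)]
    simp only [lt_irrefl, if_false, one_mul]
    refine prod_congr rfl fun q hq ↦ ?_
    rcases lt_or_gt_of_ne (mem_erase.1 hq).1 with h | h <;> simp [h, h.not_gt]
  rw [h1]
  simp only [prod_mul_distrib]
  rw [prod_comm (f := fun p q ↦ if q < p then g p q else 1)]
  simp only [prod_Ioi_eq_prod_ite]

/-- The enumeration of the slots: `n` particles of charge `1`, then two slots for each of the `k`
particles of charge `2`. -/
def slotEquiv (n k : ℕ) : Fin n ⊕ (Fin k ⊕ Fin k) ≃ Fin (n + (k + k)) :=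
  (Equiv.sumCongr (Equiv.refl _) finSumFinEquiv).trans finSumFinEquiv

/-- The Gaussian factors and the Vandermonde product of the points `x`, `z`, `u`, without the
differences `u p - z p`. It is what remains of the Vandermonde product when each `u p` merges with
`z p`. -/
noncomputable def confluentFactor {n k : ℕ} (x : Fin n → ℝ) (z u : Fin k → ℝ) : ℝ :=
  ((∏ i, hermiteFun 0 (x i)) * (∏ q, hermiteFun 0 (z q)) * ∏ q, hermiteFun 0 (u q)) *
  ((∏ i, ∏ j ∈ Ioi i, (x j - x i)) * (∏ i, ∏ q, (z q - x i) * (u q - x i)) *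
    ((∏ p, ∏ q ∈ Ioi p, (z q - z p)) * (∏ p, ∏ q ∈ Ioi p, (u q - u p)) *
    ∏ p, ∏ q ∈ univ.erase p, (u q - z p)))

lemma exists_det_hermiteFun_slots {n k : ℕ} (d : Fin n ⊕ (Fin k ⊕ Fin k) ≃ Fin (n + (k + k))) :
    ∃ ε : ℝ, ε * ε = 1 ∧ ∀ (x : Fin n → ℝ) (z u : Fin k → ℝ),
      (Matrix.of fun c i : Fin n ⊕ (Fin k ⊕ Fin k) ↦
        hermiteFun (d c) (Sum.elim x (Sum.elim z u) i)).det =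
      ε * (confluentFactor x z u * ∏ p, (u p - z p)) := by
  set e := slotEquiv n k with he
  refine ⟨((Equiv.Perm.sign (e.symm.trans d) : ℤ) : ℝ) *
    ∏ j : Fin (n + (k + k)), (-1 : ℝ) ^ (j : ℕ), ?_, fun x z u ↦ ?_⟩
  · rw [mul_mul_mul_comm, sign_mul_sign_self, ← prod_mul_distrib]
    simp [neg_one_pow_mul_self]
  set y : Fin (n + (k + k)) → ℝ := Sum.elim x (Sum.elim z u) ∘ e.symm with hy
  have hM : (Matrix.of fun c i : Fin n ⊕ (Fin k ⊕ Fin k) ↦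
        hermiteFun (d c) (Sum.elim x (Sum.elim z u) i)) =
      ((Matrix.of fun j i : Fin (n + (k + k)) ↦ hermiteFun j (y i)).submatrix
        (e.symm.trans d) id).submatrix e e := by
    ext c i
    simp [hy]
  have hy' : ∀ i j, e i = j → y j = Sum.elim x (Sum.elim z u) i := fun i j h ↦ by
    rw [← h, hy, Function.comp_apply, Equiv.symm_apply_apply]
  have hx : ∀ i, y (Fin.castAdd (k + k) i) = x i := fun i ↦ hy' (Sum.inl i) _ rfl
  have hz : ∀ q, y (Fin.natAdd n (Fin.castAdd k q)) = z q := fun q ↦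
    hy' (Sum.inr (Sum.inl q)) _ rfl
  have hu : ∀ q, y (Fin.natAdd n (Fin.natAdd k q)) = u q := fun q ↦
    hy' (Sum.inr (Sum.inr q)) _ rfl
  rw [hM, Matrix.det_submatrix_equiv_self, Matrix.det_permute, det_hermiteFun, mul_assoc]
  congr 2
  rw [prod_Ioi_add, prod_Ioi_add]
  simp only [Fin.prod_univ_add, hx, hz, hu, confluentFactor]
  have hdiag : ∏ p, ∏ q, (u q - z p) = (∏ p, ∏ q ∈ univ.erase p, (u q - z p)) *
      ∏ p, (u p - z p) := by
    rw [← prod_mul_distrib]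
    exact prod_congr rfl fun p _ ↦ (prod_erase_mul univ _ (mem_univ p)).symm
  rw [hdiag]
  simp only [prod_mul_distrib]
  ring

lemma hasDerivAt_sub_mul {G : ℝ → ℝ} {a : ℝ} (hG : ContinuousAt G a) :
    HasDerivAt (fun t ↦ (t - a) * G t) (G a) a := by
  rw [hasDerivAt_iff_tendsto_slope]
  refine (hG.tendsto.mono_left nhdsWithin_le_nhds).congr' ?_
  filter_upwards [self_mem_nhdsWithin] with t ht
  have : t - a ≠ 0 := sub_ne_zero.2 ht
  simp [slope, this]

lemma hasDerivAt_det_updateCol {ι : Type*} [Fintype ι] [DecidableEq ι] (M : Matrix ι ι ℝ) (i : ι)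
    {v : ι → ℝ → ℝ} {v' : ι → ℝ} {t : ℝ} (hv : ∀ c, HasDerivAt (v c) (v' c) t) :
    HasDerivAt (fun s ↦ (M.updateCol i fun c ↦ v c s).det) (M.updateCol i v').det t := by
  have h : ∀ w : ι → ℝ, (M.updateCol i w).det = ∑ c, M.adjugate i c * w c := fun w ↦ by
    rw [← Matrix.cramer_apply, Matrix.cramer_eq_adjugate_mulVec]
    rfl
  simp only [h]
  exact HasDerivAt.fun_sum fun c _ ↦ (hv c).const_mul _

lemma continuous_confluentFactor {n k : ℕ} (x : Fin n → ℝ) (z : Fin k → ℝ) :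
    Continuous (confluentFactor x z) := by
  unfold confluentFactor
  have := continuous_hermiteFun 0
  fun_prop

/-- The confluent determinant: for the points `u q` with `q ∈ T` that have merged with `z q`, the
column of Hermite functions is replaced by the column of their derivatives. Each further merger is
the derivative in `u a` at `z a`, where the determinant vanishes because of the factor `u a - z a`.
-/
lemma det_confluent {n k : ℕ} {d : Fin n ⊕ (Fin k ⊕ Fin k) ≃ Fin (n + (k + k))} {ε : ℝ}
    (x : Fin n → ℝ) (z : Fin k → ℝ)
    (hd : ∀ (u : Fin k → ℝ), (Matrix.of fun c i : Fin n ⊕ (Fin k ⊕ Fin k) ↦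
        hermiteFun (d c) (Sum.elim x (Sum.elim z u) i)).det =
      ε * (confluentFactor x z u * ∏ p, (u p - z p)))
    (T : Finset (Fin k)) : ∀ u : Fin k → ℝ, (∀ q ∈ T, u q = z q) →
      (Matrix.of fun c i : Fin n ⊕ (Fin k ⊕ Fin k) ↦
        hermiteFun
          (d c + Sum.elim (fun _ ↦ 0) (Sum.elim (fun _ ↦ 0) fun q ↦ if q ∈ T then 1 else 0) i)
          (Sum.elim x (Sum.elim z u) i)).det =
      ε * (confluentFactor x z u * ∏ p ∈ Tᶜ, (u p - z p)) := by
  induction T using Finset.induction_on with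
  | empty =>
    intro u _
    rw [compl_empty, ← hd]
    congr 1
    ext c (i | i | i) <;> simp
  | insert a T ha ih =>
    intro u hu
    have hua : u a = z a := hu a (mem_insert_self a T)
    set M : Matrix (Fin n ⊕ (Fin k ⊕ Fin k)) (Fin n ⊕ (Fin k ⊕ Fin k)) ℝ := Matrix.of fun c i ↦
        hermiteFun
          (d c + Sum.elim (fun _ ↦ 0) (Sum.elim (fun _ ↦ 0) fun q ↦ if q ∈ T then 1 else 0) i)
          (Sum.elim x (Sum.elim z u) i) with hM
    have h1 := hasDerivAt_det_updateCol M (Sum.inr (Sum.inr a))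
      (v := fun c ↦ hermiteFun (d c)) (v' := fun c ↦ hermiteFun (d c + 1) (z a)) (t := z a)
      (fun c ↦ hasDerivAt_hermiteFun (d c) (z a))
    have h2 : ∀ t, (M.updateCol (Sum.inr (Sum.inr a)) fun c ↦ hermiteFun (d c) t).det =
        (t - z a) * (ε * (confluentFactor x z (Function.update u a t) *
          ∏ p ∈ (insert a T)ᶜ, (u p - z p))) := fun t ↦ by
      have h3 := ih (Function.update u a t) (fun q hq ↦ by
        have hqa : q ≠ a := fun h ↦ ha (h ▸ hq)
        rw [Function.update_of_ne hqa, hu q (mem_insert_of_mem hq)])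
      have hT : Tᶜ = insert a (insert a T)ᶜ := by
        ext q; by_cases hq : q = a <;> simp [hq, ha]
      rw [hT, prod_insert (by simp), Function.update_self] at h3
      have h4 : ∏ p ∈ (insert a T)ᶜ, (Function.update u a t p - z p) =
          ∏ p ∈ (insert a T)ᶜ, (u p - z p) := prod_congr rfl fun p hp ↦ by
        rw [Function.update_of_ne]
        rintro rfl
        simp at hp
      rw [h4] at h3
      rw [show (t - z a) * (ε * (confluentFactor x z (Function.update u a t) *
          ∏ p ∈ (insert a T)ᶜ, (u p - z p))) = ε * (confluentFactor x z (Function.update u a t) *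
          ((t - z a) * ∏ p ∈ (insert a T)ᶜ, (u p - z p))) by ring, ← h3]
      congr 1
      ext c (i | i | i)
      · rw [Matrix.updateCol_ne (by simp)]
        rfl
      · rw [Matrix.updateCol_ne (by simp)]
        rfl
      · by_cases hi : i = a
        · subst hi
          rw [Matrix.updateCol_self, Matrix.of_apply, Sum.elim_inr, Sum.elim_inr, Sum.elim_inr,
            Sum.elim_inr, Function.update_self, if_neg ha, add_zero]
        · rw [Matrix.updateCol_ne (by simpa using hi), hM, Matrix.of_apply, Matrix.of_apply,
            Sum.elim_inr, Sum.elim_inr, Sum.elim_inr, Sum.elim_inr, Sum.elim_inr, Sum.elim_inr,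
            Function.update_of_ne hi]
    simp only [h2] at h1
    have h5 := hasDerivAt_sub_mul (a := z a) (G := fun t ↦
      ε * (confluentFactor x z (Function.update u a t) * ∏ p ∈ (insert a T)ᶜ, (u p - z p)))
      (by
        have := continuous_confluentFactor x z
        have h6 : Continuous fun t ↦ Function.update u a t :=
            continuous_const.update a continuous_id
        fun_prop)
    have h7 := h1.unique h5
    have h8 : Function.update u a (z a) = u := by rw [← hua, Function.update_eq_self]
    rw [h8] at h7
    rw [← h7]
    congr 1
    ext c (i | i | i)
    · simp [hM]
    · simp [hM]
    · by_cases hi : i = a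
      · subst hi
        simp [hua]
      · simp [hM, hi]

lemma twoComponentWeight_append {n k : ℕ} (x : Fin n → ℝ) (z : Fin k → ℝ) :
    twoComponentWeight n k (Fin.append x z) =
      (∏ p : Fin k, ∏ q ∈ Ioi p, (-1 : ℝ)) * (signDelta n x * confluentFactor x z z) := by
  have hc1 : ∀ i : Fin n, charge n k (Fin.castAdd k i) = 1 := fun i ↦ by simp [charge]
  have hc2 : ∀ q : Fin k, charge n k (Fin.natAdd n q) = 2 := fun _ ↦ by simp [charge]
  have hexp : Real.exp (-∑ i, (charge n k i : ℝ) * Fin.append x z i ^ 2 / 2) =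
      (∏ i, hermiteFun 0 (x i)) * (∏ q, hermiteFun 0 (z q)) * ∏ q, hermiteFun 0 (z q) := by
    simp only [hermiteFun_zero]
    rw [← Real.exp_sum, ← Real.exp_sum, ← Real.exp_add, ← Real.exp_add]
    congr 1
    simp only [Fin.sum_univ_add, hc1, hc2, Fin.append_left, Fin.append_right, neg_add,
      ← sum_neg_distrib, add_assoc]
    rw [← sum_add_distrib]
    congr 1
    · exact sum_congr rfl fun i _ ↦ by push_cast; ring
    · exact sum_congr rfl fun i _ ↦ by push_cast; ring
  have habs : ∀ a b : ℝ, |a - b| = stepSign (b - a) * (b - a) := fun a b ↦ by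
    rw [abs_sub_comm, abs_eq_stepSign_mul]
  rw [twoComponentWeight, hexp, prod_Ioi_add]
  simp only [hc1, hc2, Fin.append_left, Fin.append_right, confluentFactor, prod_prod_ne, signDelta]
  have e1 : ∀ a b : ℝ, |a - b| ^ (1 * 2) = (b - a) * (b - a) := fun a b ↦ by
    rw [one_mul, sq_abs]; ring
  have e2 : ∀ a b : ℝ, |a - b| ^ (2 * 2) =
      (-1) * ((b - a) * (b - a) * ((b - a) * (a - b))) := fun a b ↦ by
    rw [pow_mul, sq_abs]; ring
  simp only [e1, e2]
  simp only [one_mul, pow_one, habs, prod_mul_distrib]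
  ring
end Confluent

/-! ### Integration of the Boltzmann factor -/

section Integration
open Finset

/-- The measurable equivalence given by `Fin.append`. -/
def finAppendEquiv (n k : ℕ) : (Fin n → ℝ) × (Fin k → ℝ) ≃ᵐ (Fin (n + k) → ℝ) :=
  (MeasurableEquiv.sumPiEquivProdPi (fun _ : Fin n ⊕ Fin k ↦ ℝ)).symm.trans
    (MeasurableEquiv.piCongrLeft (fun _ ↦ ℝ) finSumFinEquiv)

lemma measurePreserving_finAppendEquiv (n k : ℕ) : MeasurePreserving (finAppendEquiv n k) :=
  (volume_measurePreserving_sumPiEquivProdPi_symm (fun _ : Fin n ⊕ Fin k ↦ ℝ)).trans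
    (volume_measurePreserving_piCongrLeft (fun _ ↦ ℝ) finSumFinEquiv)

lemma finAppendEquiv_apply {n k : ℕ} (x : Fin n → ℝ) (z : Fin k → ℝ) :
    finAppendEquiv n k (x, z) = Fin.append x z := by
  ext i
  obtain ⟨j, rfl⟩ := finSumFinEquiv.surjective i
  have : finAppendEquiv n k (x, z) (finSumFinEquiv j) =
      (MeasurableEquiv.sumPiEquivProdPi (fun _ : Fin n ⊕ Fin k ↦ ℝ)).symm (x, z) j :=
    Equiv.piCongrLeft_apply_apply (P := fun _ ↦ ℝ) finSumFinEquiv _ j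
  rw [this]
  rcases j with j | j
  · simp [MeasurableEquiv.coe_sumPiEquivProdPi_symm]
  · simp [MeasurableEquiv.coe_sumPiEquivProdPi_symm]

/-- The Boltzmann factor is, up to a global sign, the sign of the Vandermonde product of the
particles of charge `1` times a determinant of Hermite functions and their derivatives. Since all
its factors belonging to charge `2` are even powers, no other sign is needed. `g` lists the degrees
in any order. -/
lemma exists_twoComponentWeight_eq_sum {n k : ℕ} (g : Fin n ⊕ (Fin k ⊕ Fin k) → ℕ)
    (hg : Function.Injective g) (hlt : ∀ c, g c < n + (k + k)) :
    ∃ ε : ℝ, ε * ε = 1 ∧ ∀ (x : Fin n → ℝ) (z : Fin k → ℝ),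
      twoComponentWeight n k (Fin.append x z) =
      ε * ∑ σ : Equiv.Perm (Fin n ⊕ (Fin k ⊕ Fin k)), ((Equiv.Perm.sign σ : ℤ) : ℝ) *
        ((signDelta n x * ∏ i, hermiteFun (g (σ (Sum.inl i))) (x i)) *
          ∏ q, (hermiteFun (g (σ (Sum.inr (Sum.inl q)))) (z q) *
            hermiteFun (g (σ (Sum.inr (Sum.inr q))) + 1) (z q))) := by
  let d : Fin n ⊕ (Fin k ⊕ Fin k) ≃ Fin (n + (k + k)) :=
    Equiv.ofBijective (fun c ↦ ⟨g c, hlt c⟩) <| by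
      rw [Fintype.bijective_iff_injective_and_card]
      exact ⟨fun a b h ↦ hg (Fin.mk.inj_iff.1 h), by simp⟩
  have hdg : ∀ c, (d c : ℕ) = g c := fun c ↦ rfl
  obtain ⟨ε, hε, hdet⟩ := exists_det_hermiteFun_slots d
  refine ⟨(∏ p : Fin k, ∏ q ∈ Ioi p, (-1 : ℝ)) * ε, ?_, fun x z ↦ ?_⟩
  · rw [mul_mul_mul_comm, hε, mul_one, ← prod_mul_distrib]
    refine prod_eq_one fun p _ ↦ ?_
    rw [← prod_mul_distrib]
    simp
  have h1 := det_confluent x z (hdet x z) univ z (fun _ _ ↦ rfl)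
  rw [compl_univ, prod_empty, mul_one, Matrix.det_apply'] at h1
  simp only [Fintype.prod_sum_type, Matrix.of_apply, Sum.elim_inl, Sum.elim_inr, mem_univ, if_true,
    add_zero, hdg] at h1
  rw [twoComponentWeight_append]
  have h2 : ε * (ε * confluentFactor x z z) = confluentFactor x z z := by
    rw [← mul_assoc, hε, one_mul]
  rw [← h2, ← h1, mul_assoc]
  congr 1
  rw [mul_left_comm]
  congr 1
  rw [mul_sum]
  refine sum_congr rfl fun σ _ ↦ ?_
  simp only [prod_mul_distrib]
  ring

lemma integrable_signDelta_mul {m : ℕ} (f : Fin m → ℕ) :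
    Integrable fun x : Fin m → ℝ ↦ signDelta m x * ∏ i, hermiteFun (f i) (x i) :=
  (integrable_prod_hermiteFun f).bdd_mul (c := 1) (measurable_signDelta m).aestronglyMeasurable
    (.of_forall fun _ ↦ (abs_signDelta _ _).le)

/-- Termwise integration of `exists_twoComponentWeight_eq_sum`. -/
theorem integrable_and_abs_partition_eq {n k : ℕ} {ι : Type*} [Fintype ι] [DecidableEq ι]
    (e : Fin n ⊕ (Fin k ⊕ Fin k) ≃ ι) (g : ι → ℕ)
    (hg : Function.Injective g) (hlt : ∀ c, g c < n + (k + k)) :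
    Integrable (twoComponentWeight n k) ∧
    |twoComponentPartition n k| =
      |∑ σ : Equiv.Perm ι, ((Equiv.Perm.sign σ : ℤ) : ℝ) *
        (signIntegral n (fun i ↦ g (σ (e (Sum.inl i)))) *
          ∏ q, derivPairing (g (σ (e (Sum.inr (Sum.inl q)))))
            (g (σ (e (Sum.inr (Sum.inr q))))))| := by
  obtain ⟨ε, hε, hw⟩ := exists_twoComponentWeight_eq_sum (g ∘ e) (hg.comp e.injective)
    (fun c ↦ hlt (e c))
  have hpt : ∀ p : (Fin n → ℝ) × (Fin k → ℝ),
      twoComponentWeight n k (finAppendEquiv n k p) = _ := fun p ↦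
    (congrArg _ (finAppendEquiv_apply p.1 p.2)).trans (hw p.1 p.2)
  have hterm : ∀ σ : Equiv.Perm (Fin n ⊕ (Fin k ⊕ Fin k)),
      Integrable fun p : (Fin n → ℝ) × (Fin k → ℝ) ↦ ((Equiv.Perm.sign σ : ℤ) : ℝ) *
        ((signDelta n p.1 * ∏ i, hermiteFun ((g ∘ e) (σ (Sum.inl i))) (p.1 i)) *
          ∏ q, (hermiteFun ((g ∘ e) (σ (Sum.inr (Sum.inl q)))) (p.2 q) *
            hermiteFun ((g ∘ e) (σ (Sum.inr (Sum.inr q))) + 1) (p.2 q))) := fun σ ↦ by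
    refine Integrable.const_mul ?_ _
    exact (integrable_signDelta_mul _).mul_prod (Integrable.fintype_prod
      (f := fun q t ↦ hermiteFun ((g ∘ e) (σ (Sum.inr (Sum.inl q)))) t *
            hermiteFun ((g ∘ e) (σ (Sum.inr (Sum.inr q))) + 1) t)
      fun q ↦ integrable_hermiteFun_mul _ _)
  have hint : Integrable fun p ↦ twoComponentWeight n k (finAppendEquiv n k p) := by
    simp only [hpt]
    exact (integrable_finsetSum _ fun σ _ ↦ hterm σ).const_mul ε
  refine ⟨((measurePreserving_finAppendEquiv n k).integrable_comp_emb
    (finAppendEquiv n k).measurableEmbedding).1 hint, ?_⟩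
  have habs : |ε| = 1 := by
    rcases mul_self_eq_one_iff.1 hε with h | h <;> simp [h]
  rw [twoComponentPartition, ← (measurePreserving_finAppendEquiv n k).integral_comp
    (finAppendEquiv n k).measurableEmbedding]
  simp only [hpt]
  rw [integral_const_mul, integral_finsetSum _ fun σ _ ↦ hterm σ, abs_mul, habs, one_mul]
  congr 1
  refine Fintype.sum_equiv e.permCongr _ _ fun σ ↦ ?_
  rw [integral_const_mul, Measure.volume_eq_prod,
    integral_prod_mul
      (fun x : Fin n → ℝ ↦ signDelta n x * ∏ i, hermiteFun ((g ∘ e) (σ (Sum.inl i))) (x i))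
      (fun z : Fin k → ℝ ↦ ∏ q, (hermiteFun ((g ∘ e) (σ (Sum.inr (Sum.inl q)))) (z q) *
        hermiteFun ((g ∘ e) (σ (Sum.inr (Sum.inr q))) + 1) (z q))),
    Equiv.Perm.sign_permCongr,
    integral_fintype_prod_volume_eq_prod
      (f := fun q t ↦ hermiteFun ((g ∘ e) (σ (Sum.inr (Sum.inl q)))) t *
            hermiteFun ((g ∘ e) (σ (Sum.inr (Sum.inr q))) + 1) t)]
  simp [signIntegral, derivPairing, Equiv.permCongr_apply]

end Integration

/-! ### Evaluation of the partition functions -/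

section Evaluation
open Finset Equiv

/-- The pairing of the slots: the slots of charge `1` are paired through `e₂`, and the two slots of
each particle of charge `2` form a pair. The left and the right copy of `Fin (m + k)` hold the
first and the second slot of each pair. -/
def pairSlotEquiv {m : ℕ} (k : ℕ) (e₂ : Fin m ⊕ Fin m ≃ Fin (2 * m)) :
    Fin (2 * m) ⊕ (Fin k ⊕ Fin k) ≃ Fin (m + k) ⊕ Fin (m + k) :=
  ((Equiv.sumCongr e₂.symm (Equiv.refl _)).trans (Equiv.sumSumSumComm _ _ _ _)).trans
    (Equiv.sumCongr finSumFinEquiv finSumFinEquiv)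

lemma hermiteDegree_injective (δ r : ℕ) : Function.Injective (hermiteDegree δ r) := by
  rintro (i | i) (j | j) h <;> simp only [hermiteDegree] at h
  · congr 1; ext; omega
  · omega
  · omega
  · congr 1; ext; omega

lemma hermiteDegree_lt (δ r : ℕ) (u : Fin r ⊕ Fin r) : hermiteDegree δ r u < 2 * r + δ := by
  rcases u with i | i <;> simp only [hermiteDegree] <;> omega

lemma sum_sign_mul_signIntegral_eq_hankelSum {δ m k : ℕ} {e₂ : Fin m ⊕ Fin m ≃ Fin (2 * m)}
    (he₂ : IsPairingExpansion e₂) :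
    ∑ σ : Perm (Fin (m + k) ⊕ Fin (m + k)), ((Perm.sign σ : ℤ) : ℝ) *
      (signIntegral (2 * m)
          (fun i ↦ hermiteDegree δ (m + k) (σ (pairSlotEquiv k e₂ (Sum.inl i)))) *
        ∏ q, derivPairing
          (hermiteDegree δ (m + k) (σ (pairSlotEquiv k e₂ (Sum.inr (Sum.inl q)))))
          (hermiteDegree δ (m + k) (σ (pairSlotEquiv k e₂ (Sum.inr (Sum.inr q)))))) =
    (Nat.doubleFactorial (2 * m - 1)) * (2 ^ (m + k) * (-2) ^ m *
      hankelSum (m + k) (shiftedMoment δ) (univ.filter fun p ↦ m ≤ (p : ℕ))) := by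
  have h1 := he₂ _ (Fin k ⊕ Fin k) (pairSlotEquiv k e₂) (hermiteDegree δ (m + k))
    (fun f ↦ ∏ q, derivPairing (f (Sum.inl q)) (f (Sum.inr q)))
  have hcard : #(univ.filter fun p : Fin (m + k) ↦ m ≤ (p : ℕ))ᶜ = m := by
    have : (univ.filter fun p : Fin (m + k) ↦ m ≤ (p : ℕ))ᶜ =
        univ.map (Fin.castAddEmb k : Fin m ↪ Fin (m + k)) := by
      ext p
      refine Fin.addCases (fun i ↦ ?_) (fun i ↦ ?_) p
      · simp
      · simp [Fin.ext_iff]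
        intro a; omega
    rw [this, card_map, card_univ, Fintype.card_fin]
  have h2 := sum_sign_mul_prod_pairings δ (m + k) (univ.filter fun p ↦ m ≤ (p : ℕ))
  rw [hcard] at h2
  rw [h1, ← h2]
  congr 1
  refine sum_congr rfl fun σ _ ↦ ?_
  rw [Fin.prod_univ_add]
  have e1 : ∀ p : Fin m, pairSlotEquiv k e₂ (Sum.inl (e₂ (Sum.inl p))) =
      Sum.inl (Fin.castAdd k p) := fun p ↦ by simp [pairSlotEquiv]
  have e2 : ∀ p : Fin m, pairSlotEquiv k e₂ (Sum.inl (e₂ (Sum.inr p))) =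
      Sum.inr (Fin.castAdd k p) := fun p ↦ by simp [pairSlotEquiv]
  have e3 : ∀ q : Fin k, pairSlotEquiv k e₂ (Sum.inr (Sum.inl q)) =
      Sum.inl (Fin.natAdd m q) := fun p ↦ by simp [pairSlotEquiv]
  have e4 : ∀ q : Fin k, pairSlotEquiv k e₂ (Sum.inr (Sum.inr q)) =
      Sum.inr (Fin.natAdd m q) := fun p ↦ by simp [pairSlotEquiv]
  have hlt : ∀ p : Fin m, ¬ m ≤ (p : ℕ) := fun p ↦ not_le.2 p.isLt
  simp [e1, e2, e3, e4, hlt]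

lemma abs_twoComponentPartition_even (m k : ℕ) :
    |twoComponentPartition (2 * m) k| = (Nat.doubleFactorial (2 * m - 1)) *
      (2 ^ (m + k) * 2 ^ m *
        |hankelSum (m + k) (shiftedMoment 0) (univ.filter fun p ↦ m ≤ (p : ℕ))|) := by
  obtain ⟨e₂, he₂⟩ := exists_isPairingExpansion m
  rw [(integrable_and_abs_partition_eq (pairSlotEquiv k e₂) (hermiteDegree 0 (m + k))
    (hermiteDegree_injective _ _) (fun u ↦ by have := hermiteDegree_lt 0 (m + k) u; omega)).2,
    sum_sign_mul_signIntegral_eq_hankelSum he₂]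
  simp [abs_mul]

/-- The degrees given by `g`, with the degree `0` added at `none`. -/
def optionDegree {α : Type*} (g : α → ℕ) : Option α → ℕ := fun o ↦ o.elim 0 g

/-- The slots of `e` with one more slot of charge `1`, which is left unpaired. -/
def optionSlotEquiv {m k : ℕ} {ι : Type*} (e : Fin m ⊕ (Fin k ⊕ Fin k) ≃ ι) :
    Fin (m + 1) ⊕ (Fin k ⊕ Fin k) ≃ Option ι where
  toFun := Sum.elim (Fin.cases none fun i ↦ some (e (Sum.inl i))) fun b ↦ some (e (Sum.inr b))
  invFun o := o.elim (Sum.inl 0) fun u ↦ Sum.map Fin.succ id (e.symm u)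
  left_inv := by
    rintro (i | b)
    · induction i using Fin.cases <;> simp
    · simp
  right_inv := by
    rintro (_ | u)
    · simp
    · obtain ⟨c, rfl⟩ := e.surjective u
      rcases c with c | c <;> simp

/-- For an odd number of particles of charge `1` one of them stays unpaired and is integrated
alone. As `∫ D ^ j w = 0` for `j ≥ 1`, it carries the degree `0`, and the remaining degrees start
at `1`. -/
lemma abs_twoComponentPartition_odd (m k : ℕ) :
    |twoComponentPartition (2 * m + 1) k| = (2 * m + 1) * |∫ t, hermiteFun 0 t| *
      ((Nat.doubleFactorial (2 * m - 1)) * (2 ^ (m + k) * 2 ^ m *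
        |hankelSum (m + k) (shiftedMoment 1) (univ.filter fun p ↦ m ≤ (p : ℕ))|)) := by
  obtain ⟨e₂, he₂⟩ := exists_isPairingExpansion m
  have hinj : Function.Injective (optionDegree (hermiteDegree 1 (m + k))) := by
    have h0 : ∀ u, hermiteDegree 1 (m + k) u ≠ 0 := fun u ↦ by
      rcases u with i | i <;> simp [hermiteDegree]
    rintro (_ | u) (_ | v) h
    · rfl
    · exact absurd h.symm (h0 v)
    · exact absurd h (h0 u)
    · exact congrArg some (hermiteDegree_injective _ _ h)
  rw [(integrable_and_abs_partition_eq (optionSlotEquiv (pairSlotEquiv k e₂))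
    (optionDegree (hermiteDegree 1 (m + k))) hinj (fun u ↦ by
      rcases u with _ | u
      · simp [optionDegree]
      · have := hermiteDegree_lt 1 (m + k) u
        simp only [optionDegree, Option.elim_some]; omega)).2,
    sum_sign_mul_signIntegral_succ (even_two_mul m) (optionSlotEquiv (pairSlotEquiv k e₂))
      (optionDegree (hermiteDegree 1 (m + k)))
      (fun f ↦ ∏ q, derivPairing (f (Sum.inl q)) (f (Sum.inr q)))]
  -- only permutations that put `hermiteFun 0` into the unpaired slot survive
  have hsum : ∑ σ : Perm (Option (Fin (m + k) ⊕ Fin (m + k))), ((Perm.sign σ : ℤ) : ℝ) *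
      ((∫ t, hermiteFun (optionDegree (hermiteDegree 1 (m + k))
          (σ (optionSlotEquiv (pairSlotEquiv k e₂) (Sum.inl 0)))) t) *
        signIntegral (2 * m) (fun i ↦ optionDegree (hermiteDegree 1 (m + k))
          (σ (optionSlotEquiv (pairSlotEquiv k e₂) (Sum.inl i.succ)))) *
        ∏ q, derivPairing
          (optionDegree (hermiteDegree 1 (m + k))
            (σ (optionSlotEquiv (pairSlotEquiv k e₂) (Sum.inr (Sum.inl q)))))
          (optionDegree (hermiteDegree 1 (m + k))
            (σ (optionSlotEquiv (pairSlotEquiv k e₂) (Sum.inr (Sum.inr q)))))) =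
      (∫ t, hermiteFun 0 t) *
      ∑ σ : Perm (Fin (m + k) ⊕ Fin (m + k)), ((Perm.sign σ : ℤ) : ℝ) *
      (signIntegral (2 * m)
          (fun i ↦ hermiteDegree 1 (m + k) (σ (pairSlotEquiv k e₂ (Sum.inl i)))) *
        ∏ q, derivPairing
          (hermiteDegree 1 (m + k) (σ (pairSlotEquiv k e₂ (Sum.inr (Sum.inl q)))))
          (hermiteDegree 1 (m + k) (σ (pairSlotEquiv k e₂ (Sum.inr (Sum.inr q)))))) := by
    rw [← Perm.decomposeOption.symm.sum_comp, Fintype.sum_prod_type, Fintype.sum_option, mul_sum]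
    refine (add_eq_left.2 (sum_eq_zero fun u _ ↦ ?_)).trans ?_
    rotate_left
    · refine sum_congr rfl fun σ _ ↦ ?_
      rw [Perm.decomposeOption_symm_sign]
      simp only [Perm.decomposeOption_symm_of_none_apply]
      simp only [optionSlotEquiv, optionDegree, Equiv.coe_fn_mk, Sum.elim_inl, Sum.elim_inr,
        Fin.cases_zero, Fin.cases_succ, Option.map_none, Option.map_some, Option.elim_none,
        Option.elim_some]
      ring
    · refine sum_eq_zero fun σ _ ↦ ?_
      have h0 : (Perm.decomposeOption.symm (some u, σ)) none = some u := by simp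
      have h1 : ∃ l, hermiteDegree 1 (m + k) u = l + 1 := by
        rcases u with i | i
        · exact ⟨_, rfl⟩
        · exact ⟨_, rfl⟩
      obtain ⟨l, hl⟩ := h1
      have h2 : optionSlotEquiv (pairSlotEquiv k e₂) (Sum.inl 0) = none := rfl
      rw [h2, h0]
      simp only [optionDegree, Option.elim_some, hl]
      rw [integral_hermiteFun_succ]
      ring
  rw [hsum, sum_sign_mul_signIntegral_eq_hankelSum he₂]
  rw [abs_mul, abs_mul, abs_mul, abs_mul, abs_mul]
  have h : |((2 * m : ℕ) : ℝ) + 1| = 2 * m + 1 := by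
    rw [abs_of_nonneg (by positivity)]; push_cast; ring
  rw [h, Nat.abs_cast, abs_pow, abs_pow]
  norm_num
  ring

lemma twoComponentPartition_nonneg (n k : ℕ) : 0 ≤ twoComponentPartition n k :=
  integral_nonneg fun _ ↦ mul_nonneg (Real.exp_pos _).le
    (prod_nonneg fun _ _ ↦ prod_nonneg fun _ _ ↦ pow_nonneg (abs_nonneg _) _)

lemma abs_hankelSum_filter_succ (δ m k : ℕ) :
    |hankelSum (m + (k + 1)) (shiftedMoment δ) (univ.filter fun p ↦ m ≤ (p : ℕ))| =
      (m + (δ + 1 / 2)) *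
      |hankelSum (m + 1 + k) (shiftedMoment δ) (univ.filter fun p ↦ m + 1 ≤ (p : ℕ))| := by
  -- both sides concern `Fin r` for the same `r`
  obtain ⟨r, hr⟩ : ∃ r, r = m + (k + 1) := ⟨_, rfl⟩
  rw [show m + 1 + k = m + (k + 1) by ring, ← hr]
  have hm : m < r := by omega
  have hins : (univ.filter fun p : Fin r ↦ m ≤ (p : ℕ)) =
      insert ⟨m, hm⟩ (univ.filter fun p : Fin r ↦ m + 1 ≤ (p : ℕ)) := by
    ext p
    simp only [mem_filter, mem_univ, true_and, mem_insert, Fin.ext_iff]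
    omega
  have hcard : #(univ.filter fun p : Fin r ↦ m + 1 ≤ (p : ℕ))ᶜ = m + 1 := by
    have : (univ.filter fun p : Fin r ↦ m + 1 ≤ (p : ℕ))ᶜ = Iic ⟨m, hm⟩ := by
      ext p
      simp [Fin.le_def]
    rw [this, Fin.card_Iic]
  rw [hins, hankelSum_insert (shiftedMoment_succ δ) _ (by simp), abs_mul, hcard, abs_neg]
  congr 1
  push_cast
  rw [add_sub_cancel_right, abs_of_nonneg (by positivity)]

/-- Merging two particles of charge `1` into one of charge `2` divides the partition function by
`4`. -/
theorem twoComponentPartition_succ (n k : ℕ) :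
    twoComponentPartition n (k + 1) = twoComponentPartition (n + 2) k / 4 := by
  rw [← abs_of_nonneg (twoComponentPartition_nonneg n (k + 1)),
    ← abs_of_nonneg (twoComponentPartition_nonneg (n + 2) k)]
  rcases Nat.even_or_odd' n with ⟨m, rfl | rfl⟩
  · rw [abs_twoComponentPartition_even, show 2 * m + 2 = 2 * (m + 1) by ring,
      abs_twoComponentPartition_even, abs_hankelSum_filter_succ,
      doubleFactorial_two_mul_succ_sub_one]
    push_cast
    ring
  · rw [abs_twoComponentPartition_odd, show 2 * m + 1 + 2 = 2 * (m + 1) + 1 by ring,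
      abs_twoComponentPartition_odd, abs_hankelSum_filter_succ,
      doubleFactorial_two_mul_succ_sub_one]
    push_cast
    ring

lemma twoComponentPartition_eq (n k : ℕ) :
    twoComponentPartition n k = twoComponentPartition (n + 2 * k) 0 / 4 ^ k := by
  induction k generalizing n with
  | zero => simp
  | succ k ih =>
    rw [twoComponentPartition_succ, ih, show n + 2 + 2 * k = n + 2 * (k + 1) by ring, pow_succ,
      div_div]

lemma goeWeight_eq (n : ℕ) : goeWeight n = twoComponentWeight n 0 := by
  ext x
  have hc : ∀ i : Fin n, charge n 0 i = 1 := fun i ↦ by simp [charge]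
  simp only [goeWeight, twoComponentWeight]
  show _ = Real.exp (-∑ i : Fin n, (charge n 0 i : ℝ) * x i ^ 2 / 2) *
    ∏ i : Fin n, ∏ j ∈ Ioi i, |x i - x j| ^ (charge n 0 i * charge n 0 j)
  simp [hc]

lemma integrable_twoComponentWeight (n k : ℕ) : Integrable (twoComponentWeight n k) :=
  (integrable_and_abs_partition_eq (slotEquiv n k) (fun i ↦ (i : ℕ)) Fin.val_injective
    (fun c ↦ c.isLt)).1

theorem mainTheorem3 (n k : ℕ) (hn : 0 < n) (hk : 0 < k) (hnk : 2 * k ≤ n) :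
    Integrable (goeWeight n) ∧
    Integrable (twoComponentWeight (n - 2 * k) k) ∧
    twoComponentPartition (n - 2 * k) k = (2 : ℝ) ^ (-(2 * (k : ℤ))) * goePartition n := by
  refine ⟨?_, integrable_twoComponentWeight _ _, ?_⟩
  · rw [goeWeight_eq]
    exact integrable_twoComponentWeight n 0
  · rw [twoComponentPartition_eq, Nat.sub_add_cancel hnk, goePartition, goeWeight_eq,
      zpow_neg, zpow_mul, zpow_natCast, div_eq_inv_mul]
    norm_num
    rfl
end Evaluation
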